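/- Let $n\equiv 2$ or $3 \pmod 4$ and let $Cl_n=Cl_{n,0}$ be the real Clifford algebra of Euclidean $\mathbb R^n$ (so $x^2=|x|^2$ for vectors $x$), with reverse $M\mapsto\widetilde M$, scalar part $\langle M\rangle_0$, modulus $|M|^2=\langle M\widetilde M\rangle_0$ and pseudoscalar $i_n=e_1e_2\cdots e_n$, for which $i_n^2=-1$. For a measure $\mu$ and a $Cl_n$-valued function $f$ put $\|f\|^2_{L^2(\mu)}=\int |f|^2\,d\mu\in[0,\infty]$. For $f\in L^2(\mathbb R^n;Cl_n)$ let $\widehat f(\omega)=\int_{\mathbb R^n} f(x)\,e^{-i_n\omega\cdot x}\,d^nx$ be its Clifford Fourier transform, understood as the $L^2$-limit for $R\to\infty$ of the integrals over $\{|x|\le R\}$. Let $d\theta$ be a Haar measure on $SO(n)$, and let $d\mu=\frac{da\,d\theta}{a^{n+1}}$ on $\mathbb R^+\times SO(n)$ and $d\lambda=d\mu\,d^nb$ on $\mathcal G=SIM(n)=\mathbb R^+\times SO(n)\rtimes\mathbb R^n$. Let $\psi\in L^2(\mathbb R^n;Cl_n)$, with values a.e. in the even part $Cl_n^+$ or values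 a.e. in the odd part $Cl_n^-$ if $n\equiv 2\pmod 4$, be an admissible wavelet with scalar admissibility constant; that is, for almost every $\omega\in\mathbb R^n$ the integral $$C_\psi=\int_{\mathbb R^+}\int_{SO(n)}a^n\,\widetilde{\widehat\psi(a\,r_\theta^{-1}\omega)}\;\widehat\psi(a\,r_\theta^{-1}\omega)\,d\mu(a,\theta)$$ converges absolutely, its value does not depend on $\omega$, and this value $C_\psi$ is invertible in $Cl_n$ and is a scalar, $C_\psi\in\mathbb R$. For $f\in L^2(\mathbb R^n;Cl_n)$ let $$T_\psi f(a,\theta,b)=\int_{\mathbb R^n}f(x)\,\widetilde{\psi_{a,\theta,b}(x)}\,d^nx,\qquad \psi_{a,\theta,b}(x)=a^{-n/2}\,\psi\!\left(r_\theta^{-1}\left(\tfrac{x-b}{a}\right)\right).$$ Then for every $f\in L^2(\mathbb R^n;Cl_n)$ $$\|b\,T_\psi f(a,\theta,b)\|^2_{L^2(\mathcal G;Cl_n)}\;\|\omega\widehat f\|^2_{L^2(\mathbb R^n;Cl_n)}\;\ge\; n\,C_\psi\,\frac{(2\pi)^n}{4}\,\|f\|^4_{L^2(\mathbb R^n;Cl_n)},$$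 where $b\,T_\psi f$ and $\omega\widehat f$ are Clifford products with the vectors $b$ and $\omega$, and the norms on the left may be infinite (with $0\cdot\infty=0$). -/

import Mathlib

open MeasureTheory Filter Topology

noncomputable section

namespace CliffordWavelet

/-- Euclidean space `ℝⁿ`. -/
abbrev E (n : ℕ) : Type := EuclideanSpace ℝ (Fin n)

/-- The quadratic form `x ↦ x · x` on `ℝⁿ`. -/
def euclideanForm (n : ℕ) : QuadraticForm ℝ (E n) :=
  LinearMap.BilinMap.toQuadraticMap (innerₗ (E n))

/-- The real Clifford geometric algebra `Clₙ = Cl_{n,0}`. -/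
abbrev Cl (n : ℕ) : Type := CliffordAlgebra (euclideanForm n)

/-- A vector of `ℝⁿ`, seen as a multivector. -/
def vec {n : ℕ} (x : E n) : Cl n := CliffordAlgebra.ι (euclideanForm n) x

/-- The reverse `M̃`. -/
def rev {n : ℕ} (M : Cl n) : Cl n := CliffordAlgebra.reverse M

/-- The scalar part `⟨M⟩₀`: the grade-zero part, the grades being those of the exterior algebra
under the canonical linear isomorphism `Clₙ ≃ ⋀ ℝⁿ`. -/
def scalarPart {n : ℕ} (M : Cl n) : ℝ :=
  ExteriorAlgebra.algebraMapInv (CliffordAlgebra.equivExterior (euclideanForm n) M)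

/-- `|M|² = ⟨M M̃⟩₀`. -/
def modSq {n : ℕ} (M : Cl n) : ℝ := scalarPart (M * rev M)

/-- The basis blade `e_A = e_{i₁} ⋯ e_{iₖ}` for `A = {i₁ < ⋯ < iₖ}`. -/
def blade {n : ℕ} (A : Finset (Fin n)) : Cl n :=
  ((A.sort (· ≤ ·)).map fun i => vec (EuclideanSpace.single i (1 : ℝ))).prod

/-- The blade coefficient `M_A = ⟨M ẽ_A⟩₀` in `M = ∑_A M_A e_A`. -/
def coeff {n : ℕ} (A : Finset (Fin n)) (M : Cl n) : ℝ := scalarPart (M * rev (blade A))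

/-- The unit pseudoscalar `iₙ = e₁ e₂ ⋯ eₙ`. -/
def pseudoscalar (n : ℕ) : Cl n := blade Finset.univ

/-- `exp (t iₙ) = cos t + iₙ sin t`, for `iₙ² = -1`. -/
def expI (n : ℕ) (t : ℝ) : Cl n :=
  algebraMap ℝ (Cl n) (Real.cos t) + Real.sin t • pseudoscalar n

section Integration

variable {n : ℕ} {α : Type*} [MeasurableSpace α]

/-- Integrability of a multivector function: every blade component is integrable. -/
def ClIntegrable (μ : Measure α) (f : α → Cl n) : Prop :=
  ∀ A : Finset (Fin n), Integrable (fun x => coeff A (f x)) μ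

/-- The multivector integral `∫ f dμ = ∑_A (∫ f_A dμ) e_A`. -/
def clIntegral (μ : Measure α) (f : α → Cl n) : Cl n :=
  ∑ A : Finset (Fin n), (∫ x, coeff A (f x) ∂μ) • blade A

/-- `‖f‖² = ∫ |f|² dμ`, possibly infinite. -/
def normSq (μ : Measure α) (f : α → Cl n) : ENNReal :=
  ∫⁻ x, ENNReal.ofReal (modSq (f x)) ∂μ

/-- `f ∈ L²(μ; Clₙ)`. -/
def MemL2 (μ : Measure α) (f : α → Cl n) : Prop :=
  (∀ A : Finset (Fin n), AEStronglyMeasurable (fun x => coeff A (f x)) μ) ∧ normSq μ f < ⊤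

end Integration

/-- The Clifford Fourier integral `∫ f(x) exp(-iₙ ω·x) dⁿx`. -/
def cftIntegral {n : ℕ} (f : E n → Cl n) (ω : E n) : Cl n :=
  clIntegral volume fun x => f x * expI n (-(inner ℝ ω x))

/-- `g` is the Clifford Fourier transform of `f` in the sense of Plancherel:
`g ∈ L²` is the `L²`-limit of `∫_{|x| ≤ R} f(x) exp(-iₙ ω·x) dⁿx` as `R → ∞`. -/
def IsCFT {n : ℕ} (f g : E n → Cl n) : Prop :=
  MemL2 volume g ∧
    Tendsto
      (fun R : ℝ =>
        normSq volume fun ω => cftIntegral ((Metric.closedBall 0 R).indicator f) ω - g ω)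
      atTop (𝓝 0)

/-- The Clifford Fourier transform `f̂` of `f ∈ L²(ℝⁿ; Clₙ)`: a representative of the almost
everywhere unique function in `IsCFT`. -/
def cft {n : ℕ} (f : E n → Cl n) : E n → Cl n := Classical.epsilon (IsCFT f)

/-- The rotation group `SO(n)`. -/
abbrev SO (n : ℕ) : Type := Matrix.specialOrthogonalGroup (Fin n) ℝ

instance instMeasurableSpaceSO (n : ℕ) : MeasurableSpace (SO n) := borel (SO n)

instance instBorelSpaceSO (n : ℕ) : BorelSpace (SO n) := ⟨rfl⟩

/-- The action of `SO(n)` on `ℝⁿ`. -/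
def rot {n : ℕ} (r : SO n) (x : E n) : E n :=
  Matrix.toEuclideanLin (r : Matrix (Fin n) (Fin n) ℝ) x

/-- `dμ(a, θ) = da dθ / a^(n+1)` on `ℝ⁺ × SO(n)`, for a Haar measure `dθ = ν` on `SO(n)`. -/
def dilRotMeasure {n : ℕ} (ν : Measure (SO n)) : Measure (ℝ × SO n) :=
  ((volume.restrict (Set.Ioi (0 : ℝ))).withDensity
    fun a => ENNReal.ofReal (1 / a ^ (n + 1))).prod ν

/-- `dλ(a, θ, b) = dμ(a, θ) dⁿb` on `SIM(n) = ℝ⁺ × SO(n) ⋊ ℝⁿ`. -/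
def simMeasure {n : ℕ} (ν : Measure (SO n)) : Measure ((ℝ × SO n) × E n) :=
  (dilRotMeasure ν).prod volume

/-- The daughter wavelet `ψ_{a,θ,b}(x) = a^{-n/2} ψ(r_θ⁻¹((x - b)/a))`. -/
def daughter {n : ℕ} (ψ : E n → Cl n) (a : ℝ) (r : SO n) (b : E n) (x : E n) : Cl n :=
  (1 / a ^ ((n : ℝ) / 2)) • ψ (rot r⁻¹ (a⁻¹ • (x - b)))

/-- The wavelet transform `T_ψ f(a,θ,b) = ∫ f(x) ψ̃_{a,θ,b}(x) dⁿx`. -/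
def waveletTransform {n : ℕ} (ψ f : E n → Cl n) (p : (ℝ × SO n) × E n) : Cl n :=
  clIntegral volume fun x => f x * rev (daughter ψ p.1.1 p.1.2 p.2 x)

/-- The integrand `aⁿ {ψ̂(a r_θ⁻¹(ω))}~ ψ̂(a r_θ⁻¹(ω))` of the admissibility constant. -/
def admissibilityIntegrand {n : ℕ} (ψ : E n → Cl n) (ω : E n) (p : ℝ × SO n) : Cl n :=
  p.1 ^ n • (rev (cft ψ (p.1 • rot p.2⁻¹ ω)) * cft ψ (p.1 • rot p.2⁻¹ ω))

/-- `ψ` is an admissible mother wavelet with admissibility constant `C_ψ = C`. -/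
structure IsAdmissible {n : ℕ} (ν : Measure (SO n)) (ψ : E n → Cl n) (C : Cl n) : Prop where
  memL2 : MemL2 volume ψ
  /-- For `n = 2 (mod 4)` a mother wavelet is of even or of odd grade. -/
  parity : n % 4 = 2 →
    (∀ᵐ x, ψ x ∈ CliffordAlgebra.evenOdd (euclideanForm n) 0) ∨
    (∀ᵐ x, ψ x ∈ CliffordAlgebra.evenOdd (euclideanForm n) 1)
  /-- The defining integral is finite and has the constant value `C` at almost every `ω`. -/
  finite_const : ∀ᵐ ω : E n,
    ClIntegrable (dilRotMeasure ν) (admissibilityIntegrand ψ ω) ∧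
    clIntegral (dilRotMeasure ν) (admissibilityIntegrand ψ ω) = C
  invertible : IsUnit C

end CliffordWavelet

end

/-! Write $A_j=\|b_jT_\psi f\|^2$ and $B_j=\|\omega_j\widehat f\|^2$. Since a vector $v$ satisfies
$|vM|=|v||M|$, the two factors on the left are $\sum_jA_j$ and $\sum_jB_j$. It therefore suffices to
prove $A_jB_j\ge C_\psi\frac{(2\pi)^n}{4}\|f\|^4$ for each $j$ (`uncertainty_coordinate`) and to
keep the diagonal terms $\sum_jA_jB_j$ of the product.

The wavelet transform is an isometry up to a constant, $\|T_\psi f\|^2=C_\psi\|f\|^2$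
(`normSq_waveletTransform`). For fixed $(a,\theta)$, Parseval's identity shows that $T_\psi
f(a,\theta,\cdot)$ is, up to a constant and a reflection, the Fourier integral of $\widehat
f(\omega)$ times the reverse of $a^{n/2}\widehat\psi(a r_\theta^{-1}\omega)$. For this the
exponential has to move past $\widehat\psi$, which is possible because $i_n$ commutes or
anticommutes with $\psi$: it is central for $n\equiv3$, and the parity of $\psi$ settles $n\equiv2$.
Plancherel in $b$, Tonelli and admissibility then give the isometry. Plancherel itself reduces to
the complex case, right multiplication by $i_n$ being a complex structure on $Cl_n$.

The coordinate inequality is Heisenberg's argument with finite translations in place of derivatives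
(`sq_integral_norm_sq_le`). Let $\tau$ shift $b_j$ by $t$ and put $T=T_\psi f$. A change of
variables gives $t\langle T,T\circ\tau\rangle=\langle b_jT,\,T\circ\tau^{-1}-T\circ\tau\rangle$.
Translating $T$ in $b$ amounts to translating $f$, so the isometry, Plancherel and $2-2\cos s\le
s^2$ bound the squared norm of the difference by $(2t)^2K$ with $K=C_\psi(2\pi)^{-n}B_j$.
Cauchy-Schwarz, cancellation of $t^2$ and $t\to0$ yield $\|T\|^4\le4A_jK$. No differentiability of
$T$ is needed. -/

noncomputable section

namespace CliffordWavelet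

/-! ### Blades -/

section Blades

variable {n : ℕ}

/-- The product `e_{i₁} ⋯ e_{iₖ}` of basis vectors along a list of indices. -/
def listBlade (l : List (Fin n)) : Cl n :=
  (l.map fun i => vec (EuclideanSpace.single i (1 : ℝ))).prod

/-- The `i`-th basis vector as a multivector. -/
def bvec (i : Fin n) : Cl n := vec (EuclideanSpace.single i (1 : ℝ))

@[simp] lemma listBlade_nil : listBlade ([] : List (Fin n)) = 1 := rfl

lemma listBlade_cons (i : Fin n) (l : List (Fin n)) :
    listBlade (i :: l) = bvec i * listBlade l := by
  simp [listBlade, bvec]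

lemma listBlade_append (l l' : List (Fin n)) :
    listBlade (l ++ l') = listBlade l * listBlade l' := by
  simp [listBlade]

lemma blade_eq_listBlade (A : Finset (Fin n)) : blade A = listBlade (A.sort (· ≤ ·)) := rfl

lemma blade_empty : blade (∅ : Finset (Fin n)) = 1 := by simp [blade]

lemma euclideanForm_apply (x : E n) : euclideanForm n x = ‖x‖ ^ 2 := by
  simp [euclideanForm, LinearMap.BilinMap.toQuadraticMap_apply]

lemma vec_mul_vec (x : E n) : vec x * vec x = algebraMap ℝ (Cl n) (‖x‖ ^ 2) := by
  rw [vec, CliffordAlgebra.ι_sq_scalar, euclideanForm_apply]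

lemma bvec_mul_self (i : Fin n) : bvec i * bvec i = 1 := by
  simp [bvec, vec_mul_vec]

lemma bvec_mul_comm {i j : Fin n} (h : i ≠ j) : bvec i * bvec j = -(bvec j * bvec i) := by
  have := CliffordAlgebra.ι_mul_ι_add_swap (Q := euclideanForm n)
    (EuclideanSpace.single i (1 : ℝ)) (EuclideanSpace.single j (1 : ℝ))
  have h0 : QuadraticMap.polar (euclideanForm n) (EuclideanSpace.single i (1 : ℝ))
      (EuclideanSpace.single j (1 : ℝ)) = 0 := by
    rw [euclideanForm, LinearMap.BilinMap.polar_toQuadraticMap]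
    simp [EuclideanSpace.inner_single_left, h, h.symm]
  rw [eq_neg_iff_add_eq_zero]
  rwa [h0, map_zero] at this

lemma rev_one : rev (1 : Cl n) = 1 := CliffordAlgebra.reverse.map_one

lemma rev_mul (M N : Cl n) : rev (M * N) = rev N * rev M := CliffordAlgebra.reverse.map_mul M N

@[simp] lemma rev_rev (M : Cl n) : rev (rev M) = M := CliffordAlgebra.reverse_reverse M

lemma rev_add (M N : Cl n) : rev (M + N) = rev M + rev N := map_add _ M N

lemma rev_smul (c : ℝ) (M : Cl n) : rev (c • M) = c • rev M := map_smul _ c M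

lemma rev_vec (x : E n) : rev (vec x) = vec x := CliffordAlgebra.reverse_ι x

lemma rev_algebraMap (c : ℝ) : rev (algebraMap ℝ (Cl n) c) = algebraMap ℝ (Cl n) c :=
  CliffordAlgebra.reverse.commutes c

lemma rev_listBlade (l : List (Fin n)) : rev (listBlade l) = listBlade l.reverse := by
  induction l with
  | nil => exact rev_one
  | cons i l ih =>
    rw [listBlade_cons, rev_mul, ih, List.reverse_cons, listBlade_append, listBlade_cons,
      listBlade_nil, mul_one, bvec, rev_vec]

/-- Equality up to sign. -/
def EqSign (M N : Cl n) : Prop := M = N ∨ M = -N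

lemma EqSign.refl (M : Cl n) : EqSign M M := Or.inl rfl

lemma EqSign.symm {M N : Cl n} (h : EqSign M N) : EqSign N M := by
  rcases h with rfl | rfl
  · exact Or.inl rfl
  · exact Or.inr (neg_neg _).symm

lemma EqSign.trans {M N P : Cl n} (h : EqSign M N) (h' : EqSign N P) : EqSign M P := by
  rcases h with rfl | rfl <;> rcases h' with rfl | rfl <;> simp [EqSign]

lemma EqSign.mul {M N M' N' : Cl n} (h : EqSign M N) (h' : EqSign M' N') :
    EqSign (M * M') (N * N') := by
  rcases h with rfl | rfl <;> rcases h' with rfl | rfl <;> simp [EqSign]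

/-- Distinct basis vectors anticommute, so each transposition costs a sign. The sign may stay
undetermined, because products of blades matter below only through whether their scalar part
vanishes. -/
lemma eqSign_listBlade_of_perm {l l' : List (Fin n)} (h : l.Perm l') :
    EqSign (listBlade l) (listBlade l') := by
  induction h with
  | nil => exact .refl _
  | cons i _ ih => simpa only [listBlade_cons] using (EqSign.refl (bvec i)).mul ih
  | swap i j l =>
    simp only [listBlade_cons, ← mul_assoc]
    refine EqSign.mul ?_ (.refl _)
    by_cases hij : i = j
    · subst hij; exact .refl _
    · exact Or.inr (bvec_mul_comm (Ne.symm hij))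
  | trans _ _ ih ih' => exact ih.trans ih'

lemma eqSign_blade_insert {i : Fin n} {A : Finset (Fin n)} (h : i ∉ A) :
    EqSign (bvec i * blade A) (blade (insert i A)) := by
  rw [blade_eq_listBlade, blade_eq_listBlade, ← listBlade_cons]
  refine eqSign_listBlade_of_perm ?_
  rw [← Multiset.coe_eq_coe, ← Multiset.cons_coe, Finset.sort_eq, Finset.sort_eq,
    Finset.insert_val_of_notMem h]

/-- Multiplication by $e_i$ toggles the membership of $i$ in $A$, because $e_i^2=1$. -/
lemma eqSign_bvec_mul_blade (i : Fin n) (A : Finset (Fin n)) :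
    EqSign (bvec i * blade A) (blade (symmDiff {i} A)) := by
  by_cases h : i ∈ A
  · have h1 : symmDiff {i} A = A.erase i := by
      ext j; by_cases hj : j = i <;> simp [Finset.mem_symmDiff, hj, h]
    have h2 := (eqSign_blade_insert (Finset.notMem_erase i A)).symm
    rw [Finset.insert_erase h] at h2
    have h3 := (EqSign.refl (bvec i)).mul h2
    rw [← mul_assoc, bvec_mul_self, one_mul] at h3
    rwa [h1]
  · have h1 : symmDiff {i} A = insert i A := by
      ext j; by_cases hj : j = i <;> simp [Finset.mem_symmDiff, hj, h]
    rw [h1]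
    exact eqSign_blade_insert h

lemma eqSign_listBlade_mul_blade {l : List (Fin n)} (hl : l.Nodup) (B : Finset (Fin n)) :
    EqSign (listBlade l * blade B) (blade (symmDiff l.toFinset B)) := by
  induction l with
  | nil =>
    rw [listBlade_nil, one_mul, List.toFinset_nil, ← Finset.bot_eq_empty, bot_symmDiff]
    exact .refl _
  | cons i l ih =>
    rw [List.nodup_cons] at hl
    have h1 : symmDiff (i :: l).toFinset B = symmDiff {i} (symmDiff l.toFinset B) := by
      rw [← symmDiff_assoc]
      congr 1
      ext j; by_cases hj : j = i <;> simp [Finset.mem_symmDiff, hj, hl.1]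
    rw [listBlade_cons, mul_assoc, h1]
    exact ((EqSign.refl _).mul (ih hl.2)).trans (eqSign_bvec_mul_blade _ _)

lemma eqSign_blade_mul_blade (A B : Finset (Fin n)) :
    EqSign (blade A * blade B) (blade (symmDiff A B)) := by
  have := eqSign_listBlade_mul_blade (A.sort_nodup (· ≤ ·)) B
  rwa [Finset.sort_toFinset] at this

lemma eqSign_rev_blade (A : Finset (Fin n)) : EqSign (rev (blade A)) (blade A) := by
  rw [blade_eq_listBlade, rev_listBlade]
  exact eqSign_listBlade_of_perm (List.reverse_perm _)

lemma listBlade_mul_rev (l : List (Fin n)) : listBlade l * rev (listBlade l) = 1 := by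
  induction l with
  | nil => simp [rev_one]
  | cons i l ih =>
    rw [listBlade_cons, rev_mul, mul_assoc, ← mul_assoc (listBlade l), ih, one_mul, bvec, rev_vec]
    exact bvec_mul_self i

lemma blade_mul_rev (A : Finset (Fin n)) : blade A * rev (blade A) = 1 := listBlade_mul_rev _

/-! ### The scalar part -/

/-- The scalar part as a linear functional. -/
def scalarPartₗ (n : ℕ) : Cl n →ₗ[ℝ] ℝ :=
  (ExteriorAlgebra.algebraMapInv : ExteriorAlgebra ℝ (E n) →ₐ[ℝ] ℝ).toLinearMap ∘ₗ
    (CliffordAlgebra.equivExterior (euclideanForm n)).toLinearMap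

lemma scalarPartₗ_apply (M : Cl n) : scalarPartₗ n M = scalarPart M := rfl

/-- This removes the correction term in the recursion that compares the Clifford product with the
exterior product. -/
lemma contractLeft_listBlade (i : Fin n) {l : List (Fin n)} (h : i ∉ l) (d : Module.Dual ℝ (E n))
    (hd : ∀ j, j ≠ i → d (EuclideanSpace.single j 1) = 0) :
    CliffordAlgebra.contractLeft d (listBlade l) = 0 := by
  induction l with
  | nil => simp
  | cons j l ih =>
    rw [List.mem_cons, not_or] at h
    rw [listBlade_cons, bvec, vec, CliffordAlgebra.contractLeft_ι_mul, ih h.2, hd j (Ne.symm h.1)]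
    simp

lemma scalarPart_algebraMap (c : ℝ) : scalarPart (algebraMap ℝ (Cl n) c) = c := by
  simp only [scalarPart, CliffordAlgebra.equivExterior, CliffordAlgebra.changeFormEquiv_apply,
    CliffordAlgebra.changeForm_algebraMap]
  exact ExteriorAlgebra.algebraMap_leftInverse _ c

lemma scalarPart_listBlade {l : List (Fin n)} (hl : l.Nodup) (h : l ≠ []) :
    scalarPart (listBlade l) = 0 := by
  cases l with
  | nil => exact absurd rfl h
  | cons i l =>
    rw [List.nodup_cons] at hl
    simp only [scalarPart, CliffordAlgebra.equivExterior, CliffordAlgebra.changeFormEquiv_apply,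
      listBlade_cons, bvec, vec]
    -- In the exterior algebra $e_i\cdot M$ becomes $e_i\wedge M$ minus a contraction of $M$ by
    -- $e_i$. The contraction is zero by orthogonality, and the wedge has no grade-zero part.
    rw [CliffordAlgebra.changeForm_ι_mul, ← CliffordAlgebra.changeForm_contractLeft,
      contractLeft_listBlade i hl.1, map_zero, sub_zero, map_mul]
    · have : ExteriorAlgebra.algebraMapInv
          (ExteriorAlgebra.ι ℝ (EuclideanSpace.single i (1 : ℝ))) = 0 := by
        simp [ExteriorAlgebra.algebraMapInv]
      exact mul_eq_zero_of_left this _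
    · intro j hj
      rw [map_neg, LinearMap.neg_apply, LinearMap.neg_apply, euclideanForm,
        QuadraticMap.associated_toQuadraticMap]
      simp [EuclideanSpace.inner_single_left, hj, hj.symm]

lemma scalarPart_one : scalarPart (1 : Cl n) = 1 := by
  simpa using scalarPart_algebraMap (n := n) 1

lemma scalarPart_blade (A : Finset (Fin n)) : scalarPart (blade A) = if A = ∅ then 1 else 0 := by
  split_ifs with h
  · rw [h, blade_empty, scalarPart_one]
  · refine scalarPart_listBlade (A.sort_nodup _) fun h' => h ?_
    rw [← A.sort_toFinset (· ≤ ·), h', List.toFinset_nil]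

lemma scalarPart_add (M N : Cl n) : scalarPart (M + N) = scalarPart M + scalarPart N :=
  (scalarPartₗ n).map_add M N

lemma scalarPart_neg (M : Cl n) : scalarPart (-M) = -scalarPart M := (scalarPartₗ n).map_neg M

lemma scalarPart_smul (c : ℝ) (M : Cl n) : scalarPart (c • M) = c * scalarPart M :=
  (scalarPartₗ n).map_smul c M

lemma EqSign.scalarPart_eq_zero {M N : Cl n} (h : EqSign M N) (hN : scalarPart N = 0) :
    scalarPart M = 0 := by
  rcases h with rfl | rfl
  · exact hN
  · rw [scalarPart_neg, hN, neg_zero]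

lemma scalarPart_blade_mul_blade_of_ne {A B : Finset (Fin n)} (h : A ≠ B) :
    scalarPart (blade A * blade B) = 0 :=
  (eqSign_blade_mul_blade A B).scalarPart_eq_zero <| by
    rw [scalarPart_blade, if_neg]
    rwa [← Finset.bot_eq_empty, symmDiff_eq_bot]

lemma scalarPart_blade_mul_rev_blade (A B : Finset (Fin n)) :
    scalarPart (blade A * rev (blade B)) = if A = B then 1 else 0 := by
  split_ifs with h
  · rw [h, blade_mul_rev, scalarPart_one]
  · exact ((EqSign.refl _).mul (eqSign_rev_blade B)).scalarPart_eq_zero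
      (scalarPart_blade_mul_blade_of_ne h)

lemma span_range_blade : Submodule.span ℝ (Set.range (blade : Finset (Fin n) → Cl n)) = ⊤ := by
  rw [eq_top_iff]
  rintro M -
  induction M using CliffordAlgebra.left_induction with
  | algebraMap r =>
    rw [Algebra.algebraMap_eq_smul_one, ← blade_empty]
    exact Submodule.smul_mem _ _ (Submodule.subset_span ⟨_, rfl⟩)
  | add x y hx hy => exact add_mem hx hy
  | ι_mul x m hx =>
    have hm : CliffordAlgebra.ι (euclideanForm n) m = ∑ i, m i • (bvec i : Cl n) := by
      conv_lhs => rw [← (EuclideanSpace.basisFun (Fin n) ℝ).sum_repr m]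
      simp [map_sum, bvec, vec]
    rw [hm, Finset.sum_mul]
    refine sum_mem fun i _ => ?_
    rw [smul_mul_assoc]
    refine Submodule.smul_mem _ _ ?_
    induction hx using Submodule.span_induction with
    | mem x hx =>
      obtain ⟨A, rfl⟩ := hx
      rcases eqSign_bvec_mul_blade i A with h | h <;> rw [h]
      · exact Submodule.subset_span ⟨_, rfl⟩
      · exact neg_mem (Submodule.subset_span ⟨_, rfl⟩)
    | zero => simp
    | add x y _ _ hx hy => rw [mul_add]; exact add_mem hx hy
    | smul c x _ hx => rw [mul_smul_comm]; exact Submodule.smul_mem _ _ hx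

lemma exists_eq_sum_blade (M : Cl n) : ∃ c : Finset (Fin n) → ℝ, M = ∑ A, c A • blade A := by
  have : M ∈ Submodule.span ℝ (Set.range (blade : Finset (Fin n) → Cl n)) := by
    rw [span_range_blade]; trivial
  obtain ⟨c, hc⟩ := Submodule.mem_span_range_iff_exists_fun ℝ |>.1 this
  exact ⟨c, hc.symm⟩

lemma linearMap_ext_blade {V : Type*} [AddCommMonoid V] [Module ℝ V] {L L' : Cl n →ₗ[ℝ] V}
    (h : ∀ A, L (blade A) = L' (blade A)) : L = L' :=
  LinearMap.ext_on_range span_range_blade h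

/-- By bilinearity only blades matter: equal blades commute, and for distinct blades both scalar
parts vanish. This trace property makes left multiplication by the reverse an adjoint. -/
lemma scalarPart_mul_comm (M N : Cl n) : scalarPart (M * N) = scalarPart (N * M) := by
  have : (LinearMap.mul ℝ (Cl n)).compr₂ (scalarPartₗ n) =
      (LinearMap.mul ℝ (Cl n)).flip.compr₂ (scalarPartₗ n) := by
    refine linearMap_ext_blade fun A => linearMap_ext_blade fun B => ?_
    simp only [LinearMap.compr₂_apply, LinearMap.flip_apply, LinearMap.mul_apply',
      scalarPartₗ_apply]
    by_cases h : A = B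
    · rw [h]
    · rw [scalarPart_blade_mul_blade_of_ne h, scalarPart_blade_mul_blade_of_ne (Ne.symm h)]
  exact congr($this M N)

lemma scalarPart_rev (M : Cl n) : scalarPart (rev M) = scalarPart M := by
  have : scalarPartₗ n ∘ₗ CliffordAlgebra.reverse = scalarPartₗ n := by
    refine linearMap_ext_blade fun A => ?_
    change scalarPart (rev (blade A)) = scalarPart (blade A)
    by_cases h : A = ∅
    · rw [h, blade_empty, rev_one]
    · have h0 : scalarPart (blade A) = 0 := by rw [scalarPart_blade, if_neg h]
      rw [h0, (eqSign_rev_blade A).scalarPart_eq_zero h0]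
  exact congr($this M)

/-! ### The Euclidean structure on `Clₙ` -/

lemma modSq_sum_blade (c : Finset (Fin n) → ℝ) :
    modSq (∑ A, c A • blade A) = ∑ A, c A ^ 2 := by
  have h : ∀ A B : Finset (Fin n), scalarPart ((c A • blade A) * rev (c B • blade B)) =
      if A = B then c A ^ 2 else 0 := fun A B => by
    rw [rev_smul, smul_mul_smul_comm, scalarPart_smul, scalarPart_blade_mul_rev_blade]
    split_ifs with h
    · rw [h]; ring
    · ring
  have h1 : rev (∑ A, c A • blade A) = ∑ A, rev (c A • blade A) :=
    map_sum CliffordAlgebra.reverse _ _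
  rw [modSq, h1, Finset.sum_mul_sum, ← scalarPartₗ_apply, map_sum]
  simp_rw [map_sum, scalarPartₗ_apply, h]
  simp

/-- The inner product `⟨M Ñ⟩₀` on `Clₙ`. -/
@[reducible] def innerCore (n : ℕ) : InnerProductSpace.Core ℝ (Cl n) where
  inner M N := scalarPart (M * rev N)
  conj_inner_symm M N := by
    rw [← scalarPart_rev, rev_mul, rev_rev]; simp
  re_inner_nonneg M := by
    obtain ⟨c, rfl⟩ := exists_eq_sum_blade M
    change 0 ≤ modSq _
    rw [modSq_sum_blade]
    positivity
  add_left M N P := by rw [add_mul, scalarPart_add]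
  smul_left M N c := by rw [smul_mul_assoc, scalarPart_smul]; simp
  definite M h := by
    obtain ⟨c, rfl⟩ := exists_eq_sum_blade M
    replace h : modSq _ = 0 := h
    rw [modSq_sum_blade, Finset.sum_eq_zero_iff_of_nonneg fun _ _ => sq_nonneg _] at h
    refine Finset.sum_eq_zero fun A hA => ?_
    rw [pow_eq_zero_iff two_ne_zero |>.1 (h A hA), zero_smul]

/-- With the modulus as norm, the componentwise integral and `normSq` become the Bochner integral
and the square of an `eLpNorm`. -/
instance instNormedAddCommGroupCl (n : ℕ) : NormedAddCommGroup (Cl n) :=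
  (innerCore n).toNormedAddCommGroup

instance instInnerProductSpaceCl (n : ℕ) : InnerProductSpace ℝ (Cl n) :=
  InnerProductSpace.ofCore (innerCore n).toCore

lemma inner_eq_scalarPart (M N : Cl n) : inner ℝ M N = scalarPart (M * rev N) := rfl

lemma modSq_eq_norm_sq (M : Cl n) : modSq M = ‖M‖ ^ 2 := by
  rw [← real_inner_self_eq_norm_sq]; rfl

lemma coeff_eq_inner (A : Finset (Fin n)) (M : Cl n) : coeff A M = inner ℝ M (blade A) := rfl

lemma orthonormal_blade : Orthonormal ℝ (blade : Finset (Fin n) → Cl n) := by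
  rw [orthonormal_iff_ite]
  exact fun A B => scalarPart_blade_mul_rev_blade A B

/-- The orthonormal basis of blades. -/
def bladeBasis (n : ℕ) : OrthonormalBasis (Finset (Fin n)) ℝ (Cl n) :=
  OrthonormalBasis.mk orthonormal_blade span_range_blade.ge

@[simp] lemma bladeBasis_apply (A : Finset (Fin n)) : bladeBasis n A = blade A := by
  simp [bladeBasis]

instance instFiniteDimensionalCl (n : ℕ) : FiniteDimensional ℝ (Cl n) :=
  (bladeBasis n).toBasis.finiteDimensional_of_finite

lemma sum_coeff_smul_blade (M : Cl n) : ∑ A, coeff A M • blade A = M := by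
  have := (bladeBasis n).sum_repr' M
  simpa only [bladeBasis_apply, real_inner_comm, coeff_eq_inner] using this

lemma norm_sq_eq_sum_coeff (M : Cl n) : ‖M‖ ^ 2 = ∑ A, coeff A M ^ 2 := by
  conv_lhs => rw [← sum_coeff_smul_blade M, ← modSq_eq_norm_sq]
  exact modSq_sum_blade _

lemma norm_sq_eq_scalarPart (M : Cl n) : ‖M‖ ^ 2 = scalarPart (M * rev M) :=
  (modSq_eq_norm_sq M).symm

lemma norm_rev (M : Cl n) : ‖rev M‖ = ‖M‖ := by
  rw [← sq_eq_sq₀ (norm_nonneg _) (norm_nonneg _), norm_sq_eq_scalarPart, norm_sq_eq_scalarPart,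
    rev_rev, scalarPart_mul_comm]

lemma inner_mul_left_eq (M N P : Cl n) : inner ℝ (M * N) P = inner ℝ N (rev M * P) := by
  rw [inner_eq_scalarPart, inner_eq_scalarPart, rev_mul, rev_rev, mul_assoc, scalarPart_mul_comm,
    mul_assoc]

lemma inner_mul_right_eq (M N P : Cl n) : inner ℝ (M * N) P = inner ℝ M (P * rev N) := by
  rw [inner_eq_scalarPart, inner_eq_scalarPart, rev_mul, rev_rev, mul_assoc]

/-- Left multiplication by a vector is self-adjoint with square $|x|^2$. This is what splits the
Clifford products of the main inequality into coordinates. -/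
lemma norm_vec_mul (x : E n) (M : Cl n) : ‖vec x * M‖ = ‖x‖ * ‖M‖ := by
  rw [← sq_eq_sq₀ (norm_nonneg _) (by positivity), mul_pow, ← real_inner_self_eq_norm_sq,
    inner_mul_left_eq, rev_vec, ← mul_assoc, vec_mul_vec, ← Algebra.smul_def, inner_smul_right,
    real_inner_self_eq_norm_sq]

/-- Right multiplication by a multivector of modulus one in the sense `U Ũ = 1`. -/
lemma norm_mul_of_mul_rev {U : Cl n} (hU : U * rev U = 1) (M : Cl n) : ‖M * U‖ = ‖M‖ := by
  rw [← sq_eq_sq₀ (norm_nonneg _) (norm_nonneg _), ← real_inner_self_eq_norm_sq,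
    inner_mul_right_eq, mul_assoc, hU, mul_one, real_inner_self_eq_norm_sq]

/-! ### The pseudoscalar -/

/-- Each factor other than $e_j$ contributes a sign as $e_j$ moves past it; a factor $e_j$
contributes none. -/
lemma bvec_mul_listBlade (j : Fin n) (l : List (Fin n)) :
    bvec j * listBlade l = (-1 : ℝ) ^ (l.countP (· ≠ j)) • (listBlade l * bvec j) := by
  induction l with
  | nil => simp
  | cons i l ih =>
    rw [listBlade_cons]
    by_cases h : i = j
    · subst h
      rw [mul_assoc (bvec i), ih, mul_smul_comm]
      simp
    · rw [← mul_assoc, bvec_mul_comm (Ne.symm h), neg_mul, mul_assoc, ih, mul_smul_comm, ← neg_smul,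
        mul_assoc, List.countP_cons_of_pos (by simpa using h), pow_succ]
      simp

lemma bvec_mul_listBlade_of_notMem {j : Fin n} {l : List (Fin n)} (h : j ∉ l) :
    bvec j * listBlade l = (-1 : ℝ) ^ l.length • (listBlade l * bvec j) := by
  rw [bvec_mul_listBlade, List.countP_eq_length.2]
  intro i hi
  have : i ≠ j := fun h' => h (h' ▸ hi)
  simpa using this

lemma rev_listBlade_of_nodup {l : List (Fin n)} (hl : l.Nodup) :
    rev (listBlade l) = (-1 : ℝ) ^ (l.length * (l.length - 1) / 2) • listBlade l := by
  induction l with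
  | nil => simp [rev_one]
  | cons i l ih =>
    rw [List.nodup_cons] at hl
    rw [listBlade_cons, rev_mul, ih hl.2, bvec_mul_listBlade_of_notMem hl.1, smul_smul, bvec,
      rev_vec, smul_mul_assoc, ← pow_add, List.length_cons, ← bvec]
    congr 1
    -- The exponent is $\binom k2$, and Pascal's rule adds the $k$ transpositions that carry $e_i$
    -- past the $k$ factors of `l`.
    rw [← Nat.choose_two_right, ← Nat.choose_two_right, Nat.choose_succ_succ' l.length 1,
      Nat.choose_one_right, add_right_comm, ← two_mul, pow_add, pow_mul]
    simp

/-- The number $\binom n2$ is odd exactly in these residue classes. The reverse then acts on $i_n$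
as complex conjugation acts on $i$. -/
lemma rev_pseudoscalar (hn : n % 4 = 2 ∨ n % 4 = 3) : rev (pseudoscalar n) = -pseudoscalar n := by
  have h := rev_listBlade_of_nodup ((Finset.univ : Finset (Fin n)).sort_nodup (· ≤ ·))
  rw [← blade_eq_listBlade, Finset.length_sort, Finset.card_univ, Fintype.card_fin] at h
  rw [pseudoscalar, h, Odd.neg_one_pow, neg_one_smul]
  rw [← Nat.choose_two_right, Nat.odd_iff]
  obtain ⟨k, hk⟩ : ∃ k, n = 4 * k + 2 ∨ n = 4 * k + 3 := ⟨n / 4, by omega⟩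
  rw [Nat.choose_two_right]
  rcases hk with hk | hk
  · have : n * (n - 1) = 2 * (2 * (4 * k ^ 2 + 3 * k) + 1) := by
      subst hk; simp only [show 4 * k + 2 - 1 = 4 * k + 1 by omega]; ring
    rw [this, Nat.mul_div_cancel_left _ two_pos]; omega
  · have : n * (n - 1) = 2 * (2 * (4 * k ^ 2 + 5 * k + 1) + 1) := by
      subst hk; simp only [show 4 * k + 3 - 1 = 4 * k + 2 by omega]; ring
    rw [this, Nat.mul_div_cancel_left _ two_pos]; omega

lemma pseudoscalar_sq (hn : n % 4 = 2 ∨ n % 4 = 3) : pseudoscalar n * pseudoscalar n = -1 := by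
  have h := blade_mul_rev (Finset.univ : Finset (Fin n))
  rw [← pseudoscalar, rev_pseudoscalar hn, mul_neg] at h
  rw [← h, neg_neg]

lemma bvec_mul_pseudoscalar (j : Fin n) :
    bvec j * pseudoscalar n = (-1 : ℝ) ^ (n - 1) • (pseudoscalar n * bvec j) := by
  have h := bvec_mul_listBlade j ((Finset.univ : Finset (Fin n)).sort (· ≤ ·))
  rw [← blade_eq_listBlade, ← pseudoscalar] at h
  rw [h]
  congr 2
  rw [← Multiset.coe_countP, Finset.sort_eq, Multiset.countP_eq_card_filter]
  change (Finset.univ.filter (· ≠ j)).card = n - 1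
  rw [Finset.filter_ne', Finset.card_erase_of_mem (Finset.mem_univ j), Finset.card_univ,
    Fintype.card_fin]

lemma vec_mul_pseudoscalar (x : E n) :
    vec x * pseudoscalar n = (-1 : ℝ) ^ (n - 1) • (pseudoscalar n * vec x) := by
  have hm : vec x = ∑ i, x i • (bvec i : Cl n) := by
    conv_lhs => rw [← (EuclideanSpace.basisFun (Fin n) ℝ).sum_repr x]
    simp [map_sum, bvec, vec]
  rw [hm, Finset.sum_mul, Finset.mul_sum, Finset.smul_sum]
  refine Finset.sum_congr rfl fun i _ => ?_
  rw [smul_mul_assoc, mul_smul_comm, bvec_mul_pseudoscalar, smul_comm]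

lemma pseudoscalar_mul_of_odd (hn : n % 2 = 1) (M : Cl n) :
    pseudoscalar n * M = M * pseudoscalar n := by
  induction M using CliffordAlgebra.left_induction with
  | algebraMap r => exact (Algebra.commutes r _).symm
  | add x y hx hy => rw [mul_add, add_mul, hx, hy]
  | ι_mul x m hx =>
    have h := vec_mul_pseudoscalar m
    rw [Even.neg_one_pow (Nat.even_iff.2 (by omega)), one_smul, vec] at h
    rw [← mul_assoc, ← h, mul_assoc, hx, mul_assoc]

/-- For even $n$ the pseudoscalar anticommutes with every vector, so moving it past a product
applies the grade involution. This is why the parity of the wavelet matters when $n\equiv2$. -/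
lemma pseudoscalar_mul_of_even (hn : n % 4 = 2) (M : Cl n) :
    pseudoscalar n * M = CliffordAlgebra.involute M * pseudoscalar n := by
  induction M using CliffordAlgebra.left_induction with
  | algebraMap r => rw [AlgHom.commutes]; exact (Algebra.commutes r _).symm
  | add x y hx hy => rw [mul_add, map_add, add_mul, hx, hy]
  | ι_mul x m hx =>
    have h := vec_mul_pseudoscalar m
    rw [Odd.neg_one_pow (Nat.odd_iff.2 (by omega)), neg_one_smul, vec] at h
    rw [map_mul, CliffordAlgebra.involute_ι, ← mul_assoc, ← neg_eq_iff_eq_neg.2 h,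
      mul_assoc (-_) _ (pseudoscalar n), ← hx]
    simp [mul_assoc]

/-! ### The exponential -/

lemma expI_zero : expI n 0 = 1 := by simp [expI]

lemma expI_add (hn : n % 4 = 2 ∨ n % 4 = 3) (s t : ℝ) : expI n (s + t) = expI n s * expI n t := by
  simp only [expI, Real.cos_add, Real.sin_add, Algebra.algebraMap_eq_smul_one, add_mul, mul_add,
    smul_mul_smul_comm, one_mul, mul_one, pseudoscalar_sq hn]
  module

lemma rev_expI (hn : n % 4 = 2 ∨ n % 4 = 3) (t : ℝ) : rev (expI n t) = expI n (-t) := by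
  simp [expI, rev_add, rev_algebraMap, rev_smul, rev_pseudoscalar hn]

lemma expI_mul_rev (hn : n % 4 = 2 ∨ n % 4 = 3) (t : ℝ) : expI n t * rev (expI n t) = 1 := by
  rw [rev_expI hn, ← expI_add hn, add_neg_cancel, expI_zero]

lemma norm_mul_expI (hn : n % 4 = 2 ∨ n % 4 = 3) (M : Cl n) (t : ℝ) : ‖M * expI n t‖ = ‖M‖ :=
  norm_mul_of_mul_rev (expI_mul_rev hn t) M

lemma norm_mul_pseudoscalar (M : Cl n) : ‖M * pseudoscalar n‖ = ‖M‖ :=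
  norm_mul_of_mul_rev (blade_mul_rev _) M

end Blades

/-! ### Plancherel's theorem for integrable square-integrable functions -/

section Plancherel

open FourierTransform SchwartzMap ContDiff

variable {V : Type*} [NormedAddCommGroup V] [InnerProductSpace ℝ V] [FiniteDimensional ℝ V]
  [MeasurableSpace V] [BorelSpace V]

lemma continuous_fourier {u : V → ℂ} (h : Integrable u) : Continuous (𝓕 u) :=
  VectorFourier.fourierIntegral_continuous Real.continuous_fourierChar
    (by exact continuous_inner) h

/-- Both transforms have the same integrals against smooth compactly supported functions: in either
case the transform can be moved onto the test function, by the multiplication formula for the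
integral and by duality of tempered distributions for the $L^2$ version. -/
lemma fourier_ae_eq_fourier_toLp {u : V → ℂ} (h1 : Integrable u) (h2 : MemLp u 2) :
    𝓕 u =ᵐ[volume] (𝓕 (h2.toLp u) : Lp ℂ 2 (volume : Measure V)) := by
  refine ae_eq_of_integral_contDiff_smul_eq (continuous_fourier h1).locallyIntegrable
    ((Lp.memLp _).locallyIntegrable (by norm_num)) fun g g_smooth g_cpt => ?_
  have hg₁ : HasCompactSupport (Complex.ofRealCLM ∘ g) := g_cpt.comp_left rfl
  have hg₂ : ContDiff ℝ ∞ (Complex.ofRealCLM ∘ g) := by fun_prop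
  set φ : 𝓢(V, ℂ) := hg₁.toSchwartzMap hg₂ with hφ
  have hφg : ∀ x (z : ℂ), φ x • z = g x • z := fun x z => by simp [hφ]
  have h3 := congr($(Lp.fourier_toTemperedDistribution_eq (h2.toLp u)) φ)
  rw [TemperedDistribution.fourier_apply, Lp.toTemperedDistribution_apply,
    Lp.toTemperedDistribution_apply] at h3
  simp_rw [hφg] at h3
  have h4 : ∫ x, g x • 𝓕 u x = ∫ x, (𝓕 φ) x • (h2.toLp u : V → ℂ) x := calc
    ∫ x, g x • 𝓕 u x = ∫ x, φ x • 𝓕 u x := by simp_rw [hφg]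
    _ = ∫ x, 𝓕 (φ : V → ℂ) x • u x := by
      simpa using! (VectorFourier.integral_fourierIntegral_smul_eq_flip (L := innerₗ V)
        (μ := volume) (ν := volume) Real.continuous_fourierChar continuous_inner
        φ.integrable h1).symm
    _ = ∫ x, (𝓕 φ) x • (h2.toLp u : V → ℂ) x := by
      refine integral_congr_ae ?_
      filter_upwards [h2.coeFn_toLp] with x hx
      rw [hx, SchwartzMap.fourier_coe]
  exact h4.trans h3

lemma eLpNorm_fourier {u : V → ℂ} (h1 : Integrable u) (h2 : MemLp u 2) :
    eLpNorm (𝓕 u) 2 volume = eLpNorm u 2 volume := by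
  rw [eLpNorm_congr_ae (fourier_ae_eq_fourier_toLp h1 h2), ← eLpNorm_congr_ae h2.coeFn_toLp,
    ← Lp.enorm_def, ← Lp.enorm_def, ← ofReal_norm, ← ofReal_norm, Lp.norm_fourier_eq]

lemma eLpNorm_two_sq {α F : Type*} [MeasurableSpace α] [NormedAddCommGroup F] (μ : Measure α)
    (f : α → F) : eLpNorm f 2 μ ^ 2 = ∫⁻ x, ‖f x‖ₑ ^ 2 ∂μ := by
  rw [eLpNorm_eq_lintegral_rpow_enorm_toReal two_ne_zero ENNReal.ofNat_ne_top]
  simp only [ENNReal.toReal_ofNat, ENNReal.rpow_ofNat, one_div]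
  rw [← ENNReal.rpow_natCast, ← ENNReal.rpow_mul]
  norm_num

lemma lintegral_fourier_sq {u : V → ℂ} (h1 : Integrable u) (h2 : MemLp u 2) :
    ∫⁻ x, ‖𝓕 u x‖ₑ ^ 2 = ∫⁻ x, ‖u x‖ₑ ^ 2 := by
  rw [← eLpNorm_two_sq, ← eLpNorm_two_sq, eLpNorm_fourier h1 h2]

end Plancherel

/-! ### Integration of multivector functions -/

section Integration

variable {n : ℕ} {α : Type*} [MeasurableSpace α] {μ : Measure α}

/-- Multiplication of multivectors as a continuous bilinear map. -/
def mulL (n : ℕ) : Cl n →L[ℝ] Cl n →L[ℝ] Cl n := (LinearMap.mul ℝ (Cl n)).toContinuousBilinearMap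

lemma mulL_apply (M N : Cl n) : mulL n M N = M * N := rfl

instance instContinuousMulCl (n : ℕ) : ContinuousMul (Cl n) :=
  ⟨(mulL n).continuous₂⟩

/-- The blade coefficient as a continuous linear map. -/
def coeffL (A : Finset (Fin n)) : Cl n →L[ℝ] ℝ := innerSL ℝ (blade A)

lemma coeffL_apply (A : Finset (Fin n)) (M : Cl n) : coeffL A M = coeff A M := by
  rw [coeffL, innerSL_apply_apply, real_inner_comm, coeff_eq_inner]

/-- The reverse as a continuous linear map. -/
def revL (n : ℕ) : Cl n →L[ℝ] Cl n :=
  (CliffordAlgebra.reverse : Cl n →ₗ[ℝ] Cl n).toContinuousLinearMap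

@[fun_prop] lemma continuous_rev : Continuous (rev : Cl n → Cl n) := (revL n).continuous

@[fun_prop] lemma continuous_expI : Continuous (expI n) := by
  unfold expI
  have : Continuous (algebraMap ℝ (Cl n)) :=
    ((Algebra.linearMap ℝ (Cl n)).toContinuousLinearMap).continuous
  fun_prop

lemma aestronglyMeasurable_iff_coeff {f : α → Cl n} : AEStronglyMeasurable f μ ↔
    ∀ A : Finset (Fin n), AEStronglyMeasurable (fun x => coeff A (f x)) μ := by
  constructor
  · intro h A
    simp_rw [← coeffL_apply]
    exact (coeffL A).continuous.comp_aestronglyMeasurable h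
  · intro h
    have : f = fun x => ∑ A, coeff A (f x) • blade A := by
      ext x; rw [sum_coeff_smul_blade]
    rw [this]
    exact Finset.aestronglyMeasurable_fun_sum _ fun A _ => (h A).smul_const _

lemma clIntegrable_iff {f : α → Cl n} : ClIntegrable μ f ↔ Integrable f μ := by
  constructor
  · intro h
    have : f = fun x => ∑ A, coeff A (f x) • blade A := by
      ext x; rw [sum_coeff_smul_blade]
    rw [this]
    exact integrable_finsetSum _ fun A _ => (h A).smul_const _
  · intro h A
    simp_rw [← coeffL_apply]
    exact (coeffL A).integrable_comp h

lemma clIntegral_eq_integral {f : α → Cl n} (h : Integrable f μ) :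
    clIntegral μ f = ∫ x, f x ∂μ := by
  rw [clIntegral, ← sum_coeff_smul_blade (∫ x, f x ∂μ)]
  refine Finset.sum_congr rfl fun A _ => ?_
  simp_rw [← coeffL_apply]
  rw [(coeffL A).integral_comp_comm h]

lemma ofReal_modSq (M : Cl n) : ENNReal.ofReal (modSq M) = ‖M‖ₑ ^ 2 := by
  rw [modSq_eq_norm_sq, ENNReal.ofReal_pow (norm_nonneg _), ofReal_norm]

lemma normSq_eq_lintegral (f : α → Cl n) : normSq μ f = ∫⁻ x, ‖f x‖ₑ ^ 2 ∂μ := by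
  simp_rw [normSq, ofReal_modSq]

lemma normSq_eq_eLpNorm_sq (f : α → Cl n) : normSq μ f = eLpNorm f 2 μ ^ 2 := by
  rw [eLpNorm_two_sq, normSq_eq_lintegral]

lemma memL2_iff {f : α → Cl n} : MemL2 μ f ↔ MemLp f 2 μ := by
  rw [MemL2, MemLp, ← aestronglyMeasurable_iff_coeff, normSq_eq_eLpNorm_sq, lt_top_iff_ne_top,
    lt_top_iff_ne_top, Ne, Ne, ENNReal.pow_eq_top_iff]
  simp

lemma normSq_congr_ae {f g : α → Cl n} (h : f =ᵐ[μ] g) : normSq μ f = normSq μ g := by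
  rw [normSq_eq_eLpNorm_sq, normSq_eq_eLpNorm_sq, eLpNorm_congr_ae h]

lemma clIntegral_congr_ae {f g : α → Cl n} (h : f =ᵐ[μ] g) : clIntegral μ f = clIntegral μ g := by
  unfold clIntegral
  refine Finset.sum_congr rfl fun A _ => ?_
  congr 1
  refine integral_congr_ae ?_
  filter_upwards [h] with x hx
  rw [hx]

/-- The product of square-integrable multivector functions is integrable. -/
lemma integrable_mul_of_memLp {f g : α → Cl n} (hf : MemLp f 2 μ) (hg : MemLp g 2 μ) :
    Integrable (fun x => f x * g x) μ := by
  refine Integrable.mono' ((hf.norm.integrable_mul hg.norm).const_mul ‖mulL n‖)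
    (hf.1.mul hg.1) (ae_of_all _ fun x => ?_)
  rw [← mulL_apply]
  refine ((mulL n).le_opNorm₂ _ _).trans (le_of_eq ?_)
  simp [mul_assoc]

end Integration

/-! ### The Clifford Fourier integral -/

section FourierIntegral

open FourierTransform

variable {n : ℕ}

/-- The complex coordinate `⟨M ẽ_A⟩₀ - i ⟨M iₙ ẽ_A⟩₀` of a multivector: right multiplication by
`iₙ` becomes multiplication by the complex unit. -/
def complexCoord (A : Finset (Fin n)) : Cl n →L[ℝ] ℂ :=
  (coeffL A).smulRight (1 : ℂ) -
    ((coeffL A).comp ((mulL n).flip (pseudoscalar n))).smulRight Complex.I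

lemma complexCoord_apply (A : Finset (Fin n)) (M : Cl n) :
    complexCoord A M = coeff A M - coeff A (M * pseudoscalar n) * Complex.I := by
  simp [complexCoord, coeffL_apply, mulL_apply]

/-- The coordinates are redundant: the real parts are the components of $M$, the imaginary parts up
to sign those of $Mi_n$, and both have the norm of $M$. Hence the factor 2. -/
lemma sum_norm_complexCoord_sq (M : Cl n) : ∑ A, ‖complexCoord A M‖ ^ 2 = 2 * ‖M‖ ^ 2 := by
  have h : ∀ A, ‖complexCoord A M‖ ^ 2 = coeff A M ^ 2 + coeff A (M * pseudoscalar n) ^ 2 := by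
    intro A
    rw [complexCoord_apply, ← Complex.normSq_eq_norm_sq, Complex.normSq_apply]
    simp
    ring
  simp_rw [h]
  rw [Finset.sum_add_distrib, ← norm_sq_eq_sum_coeff, ← norm_sq_eq_sum_coeff,
    norm_mul_pseudoscalar, two_mul]

lemma sum_enorm_complexCoord_sq (M : Cl n) : ∑ A, ‖complexCoord A M‖ₑ ^ 2 = 2 * ‖M‖ₑ ^ 2 := by
  have h := congr(ENNReal.ofReal $(sum_norm_complexCoord_sq M))
  rw [ENNReal.ofReal_sum_of_nonneg fun _ _ => by positivity, ENNReal.ofReal_mul two_pos.le] at h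
  simpa [ENNReal.ofReal_pow] using h

lemma complexCoord_mul_expI (hn : n % 4 = 2 ∨ n % 4 = 3) (A : Finset (Fin n)) (M : Cl n) (t : ℝ) :
    complexCoord A (M * expI n t) = Complex.exp (t * Complex.I) * complexCoord A M := by
  have hI : complexCoord A (M * pseudoscalar n) = Complex.I * complexCoord A M := by
    rw [complexCoord_apply, complexCoord_apply, mul_assoc, pseudoscalar_sq hn, mul_neg, mul_one,
      ← coeffL_apply A (-M), map_neg, coeffL_apply]
    push_cast
    ring_nf
    rw [Complex.I_sq]
    ring
  rw [expI, mul_add, mul_smul_comm, map_add, map_smul, hI, ← Algebra.commutes, ← Algebra.smul_def,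
    map_smul, Complex.exp_mul_I, ← Complex.ofReal_cos, ← Complex.ofReal_sin]
  simp only [Complex.real_smul]
  ring

lemma integrable_mul_expI (hn : n % 4 = 2 ∨ n % 4 = 3) {f : E n → Cl n} (hf : Integrable f)
    {φ : E n → ℝ} (hφ : Continuous φ) : Integrable fun x => f x * expI n (φ x) := by
  refine hf.norm.mono' ?_ (ae_of_all _ fun x => (norm_mul_expI hn _ _).le)
  exact hf.1.mul (by fun_prop)

lemma cftIntegral_eq_integral (hn : n % 4 = 2 ∨ n % 4 = 3) {f : E n → Cl n} (hf : Integrable f)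
    (ω : E n) : cftIntegral f ω = ∫ x, f x * expI n (-(inner ℝ ω x)) :=
  clIntegral_eq_integral (integrable_mul_expI hn hf (by fun_prop))

lemma continuous_cftIntegral (hn : n % 4 = 2 ∨ n % 4 = 3) {f : E n → Cl n} (hf : Integrable f) :
    Continuous (cftIntegral f) := by
  have : cftIntegral f = fun ω => ∫ x, f x * expI n (-(inner ℝ ω x)) := by
    ext ω; exact cftIntegral_eq_integral hn hf ω
  rw [this]
  refine continuous_of_dominated (bound := fun x => ‖f x‖) (fun ω => ?_) (fun ω => ?_) hf.norm ?_
  · exact (integrable_mul_expI hn hf (by fun_prop)).1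
  · exact ae_of_all _ fun x => (norm_mul_expI hn _ _).le
  · exact ae_of_all _ fun x => by fun_prop

/-- The rescaling by $(2\pi)^{-1}$ converts the kernel $e^{-2\pi i\,x\cdot\xi}$ of `𝓕` into
$e^{-i\,\omega\cdot x}$; it is the source of the factor $(2\pi)^n$ in Plancherel's theorem. -/
lemma complexCoord_cftIntegral (hn : n % 4 = 2 ∨ n % 4 = 3) {f : E n → Cl n} (hf : Integrable f)
    (A : Finset (Fin n)) (ω : E n) :
    complexCoord A (cftIntegral f ω) = 𝓕 (fun x => complexCoord A (f x)) ((2 * Real.pi)⁻¹ • ω) := by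
  rw [cftIntegral_eq_integral hn hf, ← (complexCoord A).integral_comp_comm
    (integrable_mul_expI hn hf (by fun_prop)), Real.fourier_eq']
  refine integral_congr_ae (ae_of_all _ fun x => ?_)
  simp only
  rw [complexCoord_mul_expI hn, inner_smul_right, real_inner_comm, smul_eq_mul]
  congr 3
  have : Real.pi ≠ 0 := Real.pi_ne_zero
  push_cast
  field_simp

lemma lintegral_comp_inv_smul {c : ℝ} (hc : 0 < c) (g : E n → ENNReal) :
    ∫⁻ x, g (c⁻¹ • x) = ENNReal.ofReal (c ^ n) * ∫⁻ x, g x := by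
  have h := lintegral_map_equiv (μ := (volume : Measure (E n))) g
    (Homeomorph.smulOfNeZero c⁻¹ (inv_ne_zero hc.ne')).toMeasurableEquiv
  have h2 := Measure.map_addHaar_smul (volume : Measure (E n)) (inv_ne_zero hc.ne')
  simp only [Homeomorph.toMeasurableEquiv_coe, Homeomorph.smulOfNeZero_apply] at h
  change ∫⁻ x, g x ∂(Measure.map (c⁻¹ • ·) volume) = _ at h
  rw [← h, h2, lintegral_smul_measure]
  simp [abs_of_pos hc]

/-- Plancherel's theorem for the Clifford Fourier integral. -/
lemma normSq_cftIntegral (hn : n % 4 = 2 ∨ n % 4 = 3) {f : E n → Cl n} (hf : Integrable f)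
    (hf2 : MemLp f 2) :
    normSq volume (cftIntegral f) = ENNReal.ofReal ((2 * Real.pi) ^ n) * normSq volume f := by
  have key : ∀ g : E n → Cl n, AEStronglyMeasurable g →
      2 * normSq volume g = ∑ A, ∫⁻ x, ‖complexCoord A (g x)‖ₑ ^ 2 := by
    intro g hg
    rw [normSq_eq_lintegral, ← lintegral_const_mul'' _ (hg.enorm.pow_const 2),
      ← lintegral_finsetSum']
    · simp_rw [sum_enorm_complexCoord_sq]
    · exact fun A _ => ((complexCoord A).continuous.comp_aestronglyMeasurable hg).enorm.pow_const 2
  rw [← ENNReal.mul_right_inj (a := 2) (by simp) (by simp),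
    key _ (continuous_cftIntegral hn hf).aestronglyMeasurable, mul_left_comm, key _ hf2.1,
    Finset.mul_sum]
  refine Finset.sum_congr rfl fun A _ => ?_
  simp_rw [complexCoord_cftIntegral hn hf]
  rw [lintegral_comp_inv_smul (by positivity)
    (fun y => ‖𝓕 (fun x => complexCoord A (f x)) y‖ₑ ^ 2), lintegral_fourier_sq]
  · exact (complexCoord A).integrable_comp hf
  · exact (complexCoord A).comp_memLp' hf2

end FourierIntegral

/-! ### The Clifford Fourier transform on $L^2$ -/

section Transform

variable {n : ℕ}

/-- The constant `(2π)^{n/2}` by which the Clifford Fourier transform scales the `L²` norm. -/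
def plancherelConst (n : ℕ) : ENNReal := ENNReal.ofReal (√((2 * Real.pi) ^ n))

lemma plancherelConst_sq (n : ℕ) : plancherelConst n ^ 2 = ENNReal.ofReal ((2 * Real.pi) ^ n) := by
  rw [plancherelConst, ← ENNReal.ofReal_pow (Real.sqrt_nonneg _), Real.sq_sqrt (by positivity)]

lemma plancherelConst_ne_top (n : ℕ) : plancherelConst n ≠ ⊤ := ENNReal.ofReal_ne_top

lemma eLpNorm_cftIntegral (hn : n % 4 = 2 ∨ n % 4 = 3) {f : E n → Cl n} (hf : Integrable f)
    (hf2 : MemLp f 2) :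
    eLpNorm (cftIntegral f) 2 volume = plancherelConst n * eLpNorm f 2 volume := by
  refine (ENNReal.pow_right_strictMono two_ne_zero).injective ?_
  rw [mul_pow, plancherelConst_sq, ← normSq_eq_eLpNorm_sq,
    ← normSq_eq_eLpNorm_sq, normSq_cftIntegral hn hf hf2]

lemma memLp_cftIntegral (hn : n % 4 = 2 ∨ n % 4 = 3) {f : E n → Cl n} (hf : Integrable f)
    (hf2 : MemLp f 2) : MemLp (cftIntegral f) 2 volume :=
  ⟨(continuous_cftIntegral hn hf).aestronglyMeasurable, by
    rw [eLpNorm_cftIntegral hn hf hf2]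
    exact ENNReal.mul_lt_top (plancherelConst_ne_top n).lt_top hf2.2⟩

lemma cftIntegral_sub (hn : n % 4 = 2 ∨ n % 4 = 3) {f g : E n → Cl n} (hf : Integrable f)
    (hg : Integrable g) : cftIntegral (f - g) = cftIntegral f - cftIntegral g := by
  ext ω
  rw [Pi.sub_apply, cftIntegral_eq_integral hn hf, cftIntegral_eq_integral hn hg,
    cftIntegral_eq_integral hn (hf.sub hg), ← integral_sub]
  · simp [sub_mul]
  · exact integrable_mul_expI hn hf (by fun_prop)
  · exact integrable_mul_expI hn hg (by fun_prop)

lemma cftIntegral_add (hn : n % 4 = 2 ∨ n % 4 = 3) {f g : E n → Cl n} (hf : Integrable f)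
    (hg : Integrable g) : cftIntegral (f + g) = cftIntegral f + cftIntegral g := by
  ext ω
  rw [Pi.add_apply, cftIntegral_eq_integral hn hf, cftIntegral_eq_integral hn hg,
    cftIntegral_eq_integral hn (hf.add hg), ← integral_add]
  · simp [add_mul]
  · exact integrable_mul_expI hn hf (by fun_prop)
  · exact integrable_mul_expI hn hg (by fun_prop)

/-- The restriction of `f` to the ball of radius `R`, extended by zero. -/
def trunc (f : E n → Cl n) (R : ℝ) : E n → Cl n := (Metric.closedBall 0 R).indicator f

lemma memLp_trunc {f : E n → Cl n} (hf : MemLp f 2) (R : ℝ) : MemLp (trunc f R) 2 :=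
  hf.indicator measurableSet_closedBall

lemma integrable_trunc {f : E n → Cl n} (hf : MemLp f 2) (R : ℝ) : Integrable (trunc f R) := by
  rw [trunc, integrable_indicator_iff measurableSet_closedBall]
  have : IsFiniteMeasure ((volume : Measure (E n)).restrict (Metric.closedBall 0 R)) :=
    isFiniteMeasure_restrict.2 (isCompact_closedBall _ _).measure_ne_top
  exact (hf.restrict _).integrable (by norm_num)

lemma tendsto_sq_zero {ι : Type*} {l : Filter ι} {u : ι → ENNReal} :
    Tendsto (fun k => u k ^ 2) l (𝓝 0) ↔ Tendsto u l (𝓝 0) := by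
  constructor
  · intro h
    have := ((ENNReal.continuous_rpow_const (y := (1 / 2 : ℝ))).tendsto 0).comp h
    refine (this.congr fun k => ?_).trans (by simp)
    simp only [Function.comp_apply, one_div]
    rw [← ENNReal.rpow_natCast, ← ENNReal.rpow_mul]
    norm_num
  · intro h
    simpa using! ((ENNReal.continuous_pow 2).tendsto 0).comp h

lemma tendsto_eLpNorm_trunc_sub {f : E n → Cl n} (hf : MemLp f 2) :
    Tendsto (fun R => eLpNorm (trunc f R - f) 2 volume) atTop (𝓝 0) := by
  rw [← tendsto_sq_zero]
  simp_rw [eLpNorm_two_sq]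
  have h0 : ∫⁻ x : E n, (0 : ENNReal) = 0 := by simp
  rw [← h0]
  refine tendsto_lintegral_filter_of_dominated_convergence' (fun x => ‖f x‖ₑ ^ 2)
    (Eventually.of_forall fun R => ?_) (Eventually.of_forall fun R => ae_of_all _ fun x => ?_) ?_
    (ae_of_all _ fun x => ?_)
  · exact (((memLp_trunc hf R).sub hf).1.enorm).pow_const 2
  · by_cases hx : x ∈ Metric.closedBall 0 R <;> simp [trunc, hx]
  · rw [← eLpNorm_two_sq]; exact ENNReal.pow_ne_top hf.2.ne
  · refine tendsto_const_nhds.congr' ?_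
    filter_upwards [eventually_ge_atTop ‖x‖] with R hR
    have : x ∈ Metric.closedBall 0 R := by simpa using hR
    simp [trunc, this]

lemma isCFT_iff {f g : E n → Cl n} : IsCFT f g ↔ MemLp g 2 ∧
    Tendsto (fun R => eLpNorm (cftIntegral (trunc f R) - g) 2 volume) atTop (𝓝 0) := by
  rw [IsCFT, memL2_iff]
  simp_rw [normSq_eq_eLpNorm_sq, tendsto_sq_zero]
  rfl

/-- The transform may be computed along any $L^2$-approximation by integrable functions, not only
along truncations to balls: by Plancherel, two approximations of $f$ have close transforms. This is
needed because translations and dilations do not preserve balls centred at 0. -/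
lemma isCFT_of_tendsto (hn : n % 4 = 2 ∨ n % 4 = 3) {f g : E n → Cl n} (hf : MemLp f 2)
    (hg : MemLp g 2) {ι : Type*} {l : Filter ι} [l.NeBot] {F : ι → E n → Cl n}
    (hF : ∀ k, Integrable (F k)) (hF2 : ∀ k, MemLp (F k) 2)
    (h1 : Tendsto (fun k => eLpNorm (F k - f) 2 volume) l (𝓝 0))
    (h2 : Tendsto (fun k => eLpNorm (cftIntegral (F k) - g) 2 volume) l (𝓝 0)) : IsCFT f g := by
  rw [isCFT_iff]
  refine ⟨hg, ?_⟩
  have key : ∀ R, eLpNorm (cftIntegral (trunc f R) - g) 2 volume ≤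
      plancherelConst n * eLpNorm (trunc f R - f) 2 volume := by
    intro R
    have h3 : Tendsto (fun k => plancherelConst n * (eLpNorm (trunc f R - f) 2 volume +
        eLpNorm (F k - f) 2 volume) + eLpNorm (cftIntegral (F k) - g) 2 volume) l
        (𝓝 (plancherelConst n * (eLpNorm (trunc f R - f) 2 volume + 0) + 0)) :=
      (ENNReal.Tendsto.const_mul (tendsto_const_nhds.add h1)
        (Or.inr (plancherelConst_ne_top n))).add h2
    rw [add_zero, add_zero] at h3
    refine ge_of_tendsto' h3 fun k => ?_
    have hT := integrable_trunc hf R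
    have hT2 := memLp_trunc hf R
    have e1 : cftIntegral (trunc f R) - g =
        cftIntegral (trunc f R - F k) + (cftIntegral (F k) - g) := by
      rw [cftIntegral_sub hn hT (hF k)]; abel
    have e2 : trunc f R - F k = (trunc f R - f) - (F k - f) := by abel
    rw [e1]
    refine (eLpNorm_add_le ?_ ?_ (by norm_num)).trans (add_le_add_left ?_ _)
    · exact (memLp_cftIntegral hn (hT.sub (hF k)) (hT2.sub (hF2 k))).1
    · exact (continuous_cftIntegral hn (hF k)).aestronglyMeasurable.sub hg.1
    · rw [eLpNorm_cftIntegral hn (hT.sub (hF k)) (hT2.sub (hF2 k)), e2]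
      gcongr
      exact eLpNorm_sub_le (hT2.sub hf).1 ((hF2 k).sub hf).1 (by norm_num)
  have h4 := ENNReal.Tendsto.const_mul (tendsto_eLpNorm_trunc_sub hf)
    (Or.inr (plancherelConst_ne_top n))
  rw [mul_zero] at h4
  exact tendsto_of_tendsto_of_tendsto_of_le_of_le tendsto_const_nhds h4 (fun _ => zero_le) key

/-- Plancherel for integrable functions scales distances by a constant, so the transforms of the
truncations are Cauchy in the complete space $L^2$. -/
lemma exists_isCFT (hn : n % 4 = 2 ∨ n % 4 = 3) {f : E n → Cl n} (hf : MemLp f 2) :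
    ∃ g, IsCFT f g := by
  let w : ℝ → Lp (Cl n) 2 (volume : Measure (E n)) := fun R => (memLp_trunc hf R).toLp
  let v : ℝ → Lp (Cl n) 2 (volume : Measure (E n)) := fun R =>
    (memLp_cftIntegral hn (integrable_trunc hf R) (memLp_trunc hf R)).toLp
  have hw : Tendsto w atTop (𝓝 hf.toLp) := by
    rw [Lp.tendsto_Lp_iff_tendsto_eLpNorm'']
    exact tendsto_eLpNorm_trunc_sub hf
  have hvw : ∀ R S, edist (v R) (v S) = plancherelConst n * edist (w R) (w S) := by
    intro R S
    rw [Lp.edist_toLp_toLp, Lp.edist_toLp_toLp,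
      ← cftIntegral_sub hn (integrable_trunc hf R) (integrable_trunc hf S),
      eLpNorm_cftIntegral hn ((integrable_trunc hf R).sub (integrable_trunc hf S))
        ((memLp_trunc hf R).sub (memLp_trunc hf S))]
  have hv : CauchySeq v := by
    have h1 := cauchySeq_iff_tendsto_dist_atTop_0.1 hw.cauchySeq
    rw [cauchySeq_iff_tendsto_dist_atTop_0]
    have h2 := h1.const_mul (plancherelConst n).toReal
    rw [mul_zero] at h2
    refine h2.congr fun p => ?_
    rw [dist_edist, dist_edist, hvw, ENNReal.toReal_mul]
  obtain ⟨g, hg⟩ := cauchySeq_tendsto_of_complete hv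
  refine ⟨g, isCFT_iff.2 ⟨Lp.memLp g, ?_⟩⟩
  rw [Lp.tendsto_Lp_iff_tendsto_eLpNorm'] at hg
  refine hg.congr fun R => eLpNorm_congr_ae ?_
  filter_upwards [(memLp_cftIntegral hn (integrable_trunc hf R) (memLp_trunc hf R)).coeFn_toLp]
    with x hx
  simp only [Pi.sub_apply, v]
  rw [hx]

lemma isCFT_cft (hn : n % 4 = 2 ∨ n % 4 = 3) {f : E n → Cl n} (hf : MemLp f 2) :
    IsCFT f (cft f) := Classical.epsilon_spec (exists_isCFT hn hf)

lemma memLp_cft (hn : n % 4 = 2 ∨ n % 4 = 3) {f : E n → Cl n} (hf : MemLp f 2) :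
    MemLp (cft f) 2 := (isCFT_iff.1 (isCFT_cft hn hf)).1

lemma IsCFT.ae_eq (hn : n % 4 = 2 ∨ n % 4 = 3) {f g g' : E n → Cl n} (hf : MemLp f 2)
    (h : IsCFT f g) (h' : IsCFT f g') : g =ᵐ[volume] g' := by
  rw [isCFT_iff] at h h'
  have h1 := h.2.add h'.2
  rw [add_zero] at h1
  have h2 : eLpNorm (g - g') 2 volume ≤ 0 := by
    refine ge_of_tendsto' h1 fun R => ?_
    have e : g - g' = (cftIntegral (trunc f R) - g') - (cftIntegral (trunc f R) - g) := by abel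
    have hm := (continuous_cftIntegral hn (integrable_trunc hf R)).aestronglyMeasurable
      (μ := (volume : Measure (E n)))
    rw [e, add_comm]
    exact eLpNorm_sub_le (hm.sub h'.1.1) (hm.sub h.1.1) (by norm_num)
  rw [nonpos_iff_eq_zero, eLpNorm_eq_zero_iff (h.1.1.sub h'.1.1) two_ne_zero] at h2
  filter_upwards [h2] with x hx
  exact sub_eq_zero.1 hx

lemma IsCFT.cft_ae_eq (hn : n % 4 = 2 ∨ n % 4 = 3) {f g : E n → Cl n} (hf : MemLp f 2)
    (h : IsCFT f g) : cft f =ᵐ[volume] g := (isCFT_cft hn hf).ae_eq hn hf h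

/-- The equality holds everywhere: the predicates `IsCFT f` and `IsCFT g` coincide, so the choice
operator returns the same representative. -/
lemma cft_congr_ae {f g : E n → Cl n} (h : f =ᵐ[volume] g) : cft f = cft g := by
  have : ∀ R, cftIntegral (trunc f R) = cftIntegral (trunc g R) := fun R => by
    ext ω
    refine clIntegral_congr_ae ?_
    filter_upwards [h] with x hx
    simp only [trunc, Set.indicator, hx]
  have h2 : IsCFT f = IsCFT g := by
    ext u; simp_rw [isCFT_iff, this]
  rw [cft, h2, cft]

lemma cft_add (hn : n % 4 = 2 ∨ n % 4 = 3) {f g : E n → Cl n} (hf : MemLp f 2)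
    (hg : MemLp g 2) : cft (f + g) =ᵐ[volume] cft f + cft g := by
  refine IsCFT.cft_ae_eq hn (hf.add hg) (isCFT_iff.2 ⟨(memLp_cft hn hf).add (memLp_cft hn hg), ?_⟩)
  have h := (isCFT_iff.1 (isCFT_cft hn hf)).2.add (isCFT_iff.1 (isCFT_cft hn hg)).2
  rw [add_zero] at h
  refine tendsto_of_tendsto_of_tendsto_of_le_of_le tendsto_const_nhds h (fun _ => zero_le)
    fun R => ?_
  have e : trunc (f + g) R = trunc f R + trunc g R := Set.indicator_add' _ _ _
  simp only
  rw [e, cftIntegral_add hn (integrable_trunc hf R) (integrable_trunc hg R), add_sub_add_comm]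
  refine eLpNorm_add_le ?_ ?_ (by norm_num)
  · exact (continuous_cftIntegral hn (integrable_trunc hf R)).aestronglyMeasurable.sub
      (memLp_cft hn hf).1
  · exact (continuous_cftIntegral hn (integrable_trunc hg R)).aestronglyMeasurable.sub
      (memLp_cft hn hg).1

lemma eLpNorm_cft (hn : n % 4 = 2 ∨ n % 4 = 3) {f : E n → Cl n} (hf : MemLp f 2) :
    eLpNorm (cft f) 2 volume = plancherelConst n * eLpNorm f 2 volume := by
  have hc := (isCFT_iff.1 (isCFT_cft hn hf)).2
  have ht := ENNReal.Tendsto.const_mul (tendsto_eLpNorm_trunc_sub hf)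
    (Or.inr (plancherelConst_ne_top n))
  have hm := fun R => (continuous_cftIntegral hn (integrable_trunc hf R)).aestronglyMeasurable
      (μ := (volume : Measure (E n)))
  rw [mul_zero] at ht
  refine le_antisymm ?_ ?_
  · have h := (hc.add ht).add (tendsto_const_nhds (x := plancherelConst n * eLpNorm f 2 volume))
    rw [zero_add, zero_add] at h
    refine ge_of_tendsto' h fun R => ?_
    have e : cft f = cftIntegral (trunc f R) - (cftIntegral (trunc f R) - cft f) := by abel
    have e' : trunc f R = (trunc f R - f) + f := by abel
    conv_lhs => rw [e]
    refine (eLpNorm_sub_le (hm R) ((hm R).sub (memLp_cft hn hf).1) (by norm_num)).trans ?_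
    rw [eLpNorm_cftIntegral hn (integrable_trunc hf R) (memLp_trunc hf R), add_assoc, ← mul_add,
      add_comm]
    gcongr
    conv_lhs => rw [e']
    exact eLpNorm_add_le ((memLp_trunc hf R).sub hf).1 hf.1 (by norm_num)
  · have h := (ht.add hc).add (tendsto_const_nhds (x := eLpNorm (cft f) 2 volume))
    rw [zero_add, zero_add] at h
    refine ge_of_tendsto' h fun R => ?_
    have e : f = trunc f R - (trunc f R - f) := by abel
    have e' : cftIntegral (trunc f R) = (cftIntegral (trunc f R) - cft f) + cft f := by abel
    conv_lhs => rw [e]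
    grw [eLpNorm_sub_le (memLp_trunc hf R).1 ((memLp_trunc hf R).sub hf).1 (by norm_num)]
    rw [mul_add, ← eLpNorm_cftIntegral hn (integrable_trunc hf R) (memLp_trunc hf R), add_assoc,
      add_comm]
    gcongr
    conv_lhs => rw [e']
    exact eLpNorm_add_le ((hm R).sub (memLp_cft hn hf).1) (memLp_cft hn hf).1 (by norm_num)

/-- Plancherel's theorem. -/
lemma normSq_cft (hn : n % 4 = 2 ∨ n % 4 = 3) {f : E n → Cl n} (hf : MemLp f 2) :
    normSq volume (cft f) = ENNReal.ofReal ((2 * Real.pi) ^ n) * normSq volume f := by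
  rw [normSq_eq_eLpNorm_sq, normSq_eq_eLpNorm_sq, eLpNorm_cft hn hf, mul_pow, plancherelConst_sq]

/-- A transformation `S` of functions that is intertwined with `S'` by the Clifford Fourier
integral is intertwined with `S'` by the Clifford Fourier transform. -/
lemma cft_intertwine (hn : n % 4 = 2 ∨ n % 4 = 3) {S S' : (E n → Cl n) → E n → Cl n}
    {C C' : ENNReal} (hC : C ≠ ⊤) (hC' : C' ≠ ⊤)
    (hS : ∀ u v, S (u - v) = S u - S v) (hS' : ∀ u v, S' (u - v) = S' u - S' v)
    (hSm : ∀ u, AEStronglyMeasurable u → AEStronglyMeasurable (S u))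
    (hSm' : ∀ u, AEStronglyMeasurable u → AEStronglyMeasurable (S' u))
    (hSn : ∀ u, AEStronglyMeasurable u → eLpNorm (S u) 2 volume ≤ C * eLpNorm u 2 volume)
    (hSn' : ∀ u, AEStronglyMeasurable u → eLpNorm (S' u) 2 volume ≤ C' * eLpNorm u 2 volume)
    (hSi : ∀ u, Integrable u → Integrable (S u))
    (hint : ∀ u, Integrable u → cftIntegral (S u) = S' (cftIntegral u))
    {f : E n → Cl n} (hf : MemLp f 2) : cft (S f) =ᵐ[volume] S' (cft f) := by
  have memS : ∀ u, MemLp u 2 → MemLp (S u) 2 := fun u hu =>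
    ⟨hSm u hu.1, (hSn u hu.1).trans_lt (ENNReal.mul_lt_top hC.lt_top hu.2)⟩
  have memS' : ∀ u, MemLp u 2 → MemLp (S' u) 2 := fun u hu =>
    ⟨hSm' u hu.1, (hSn' u hu.1).trans_lt (ENNReal.mul_lt_top hC'.lt_top hu.2)⟩
  -- The approximating family is `S (trunc f R)`, which need not be a truncation of `S f`.
  refine IsCFT.cft_ae_eq hn (memS f hf) <| isCFT_of_tendsto hn (l := atTop)
    (F := fun R : ℝ => S (trunc f R)) (memS f hf) (memS' _ (memLp_cft hn hf))
    (fun R => hSi _ (integrable_trunc hf R)) (fun R => memS _ (memLp_trunc hf R)) ?_ ?_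
  · have h := ENNReal.Tendsto.const_mul (tendsto_eLpNorm_trunc_sub hf) (Or.inr hC)
    rw [mul_zero] at h
    refine tendsto_of_tendsto_of_tendsto_of_le_of_le tendsto_const_nhds h (fun _ => zero_le)
      fun R => ?_
    simp only [← hS]
    exact hSn _ ((memLp_trunc hf R).sub hf).1
  · have h := ENNReal.Tendsto.const_mul (isCFT_iff.1 (isCFT_cft hn hf)).2 (Or.inr hC')
    rw [mul_zero] at h
    refine tendsto_of_tendsto_of_tendsto_of_le_of_le tendsto_const_nhds h (fun _ => zero_le)
      fun R => ?_
    simp only [hint _ (integrable_trunc hf R), ← hS']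
    exact hSn' _ ((continuous_cftIntegral hn (integrable_trunc hf R)).aestronglyMeasurable.sub
      (memLp_cft hn hf).1)

/-- Such an `L` is complex linear for the structure given by right multiplication by $i_n$, so it
commutes with the kernel. Left multiplications are the main example. -/
lemma cft_continuousLinearMap_comp (hn : n % 4 = 2 ∨ n % 4 = 3) (L : Cl n →L[ℝ] Cl n)
    (hL : ∀ M, L (M * pseudoscalar n) = L M * pseudoscalar n) {f : E n → Cl n} (hf : MemLp f 2) :
    cft (fun x => L (f x)) =ᵐ[volume] fun ω => L (cft f ω) := by
  have hexp : ∀ M t, L (M * expI n t) = L M * expI n t := fun M t => by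
    simp [expI, mul_add, hL, ← Algebra.commutes, ← Algebra.smul_def]
  have hm : ∀ u : E n → Cl n, AEStronglyMeasurable u → AEStronglyMeasurable fun x => L (u x) :=
    fun u hu => L.continuous.comp_aestronglyMeasurable hu
  have hb : ∀ u : E n → Cl n, AEStronglyMeasurable u →
      eLpNorm (fun x => L (u x)) 2 volume ≤ ‖L‖ₑ * eLpNorm u 2 volume := fun u hu => by
    refine (eLpNorm_le_nnreal_smul_eLpNorm_of_ae_le_mul (c := ‖L‖₊)
      (ae_of_all _ fun x => L.le_opNNNorm (u x)) 2).trans (le_of_eq rfl)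
  refine cft_intertwine hn (S := fun u x => L (u x)) (S' := fun u x => L (u x))
    (C := ‖L‖ₑ) (C' := ‖L‖ₑ) enorm_ne_top enorm_ne_top ?_ ?_ hm hm hb hb ?_ ?_ hf
  · intro u v; ext x; simp
  · intro u v; ext x; simp
  · exact fun u hu => L.integrable_comp hu
  · intro u hu
    ext ω
    rw [cftIntegral_eq_integral hn (L.integrable_comp hu), cftIntegral_eq_integral hn hu,
      ← L.integral_comp_comm (integrable_mul_expI hn hu (by fun_prop))]
    simp_rw [hexp]

/-! ### Parseval's identity -/

lemma integral_norm_sq_eq {α : Type*} [MeasurableSpace α] {μ : Measure α} {F : Type*}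
    [NormedAddCommGroup F] {f : α → F} (hf : MemLp f 2 μ) :
    ∫ x, ‖f x‖ ^ 2 ∂μ = (eLpNorm f 2 μ ^ 2).toReal := by
  rw [eLpNorm_two_sq, integral_eq_lintegral_of_nonneg_ae (ae_of_all _ fun x => by positivity)
    (by exact hf.1.norm.pow 2)]
  simp [ENNReal.ofReal_pow]

lemma integrable_inner_of_memLp {α : Type*} [MeasurableSpace α] {μ : Measure α} {f g : α → Cl n}
    (hf : MemLp f 2 μ) (hg : MemLp g 2 μ) : Integrable (fun x => inner ℝ (f x) (g x)) μ := by
  refine (hf.norm.integrable_mul hg.norm).mono' (hf.1.inner hg.1) (ae_of_all _ fun x => ?_)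
  exact norm_inner_le_norm _ _

lemma integral_norm_add_sq {α : Type*} [MeasurableSpace α] {μ : Measure α} {f g : α → Cl n}
    (hf : MemLp f 2 μ) (hg : MemLp g 2 μ) :
    ∫ x, ‖f x + g x‖ ^ 2 ∂μ =
      ∫ x, ‖f x‖ ^ 2 ∂μ + 2 * ∫ x, inner ℝ (f x) (g x) ∂μ + ∫ x, ‖g x‖ ^ 2 ∂μ := by
  simp_rw [norm_add_sq_real]
  have h := integrable_inner_of_memLp hf hg
  have h1 := hf.norm.integrable_sq
  have h2 := hg.norm.integrable_sq
  rw [integral_add (by exact h1.add (h.const_mul 2)) h2, integral_add h1 (h.const_mul 2),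
    integral_const_mul]

/-- Polarization of Plancherel's theorem, applied to $f$, $g$ and $f+g$. -/
lemma integral_inner_cft (hn : n % 4 = 2 ∨ n % 4 = 3) {f g : E n → Cl n} (hf : MemLp f 2)
    (hg : MemLp g 2) :
    ∫ ω, inner ℝ (cft f ω) (cft g ω) = (2 * Real.pi) ^ n * ∫ x, inner ℝ (f x) (g x) := by
  have key : ∀ {u : E n → Cl n}, MemLp u 2 →
      ∫ ω, ‖cft u ω‖ ^ 2 = (2 * Real.pi) ^ n * ∫ x, ‖u x‖ ^ 2 := fun {u} hu => by
    rw [integral_norm_sq_eq (memLp_cft hn hu), integral_norm_sq_eq hu, eLpNorm_cft hn hu, mul_pow,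
      plancherelConst_sq, ENNReal.toReal_mul, ENNReal.toReal_ofReal (by positivity)]
  have h1 := integral_norm_add_sq hf hg
  have h2 := integral_norm_add_sq (memLp_cft hn hf) (memLp_cft hn hg)
  have h3 : ∫ ω, ‖cft f ω + cft g ω‖ ^ 2 = ∫ ω, ‖cft (f + g) ω‖ ^ 2 := by
    refine integral_congr_ae ?_
    filter_upwards [cft_add hn hf hg] with ω hω
    rw [hω, Pi.add_apply]
  rw [h3, key (hf.add hg), key hf, key hg] at h2
  simp only [Pi.add_apply] at h2
  rw [h1] at h2
  linarith

/-- Parseval's identity in its multivector-valued form. -/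
lemma integral_cft_mul_rev_cft (hn : n % 4 = 2 ∨ n % 4 = 3) {f g : E n → Cl n} (hf : MemLp f 2)
    (hg : MemLp g 2) :
    ∫ ω, cft f ω * rev (cft g ω) = (2 * Real.pi) ^ n • ∫ x, f x * rev (g x) := by
  have hr : ∀ {u : E n → Cl n}, MemLp u 2 → MemLp (fun x => rev (u x)) 2 := fun {u} hu =>
    (revL n).comp_memLp' hu
  have i1 := integrable_mul_of_memLp (memLp_cft hn hf) (hr (memLp_cft hn hg))
  have i2 := integrable_mul_of_memLp hf (hr hg)
  refine InnerProductSpace.ext_inner_left_basis (bladeBasis n).toBasis fun A => ?_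
  rw [OrthonormalBasis.coe_toBasis, bladeBasis_apply, inner_smul_right, ← integral_inner i1,
    ← integral_inner i2]
  -- Each blade component becomes a real inner product with $e_A g$, and left multiplication by
  -- $e_A$ passes through the transform; the scalar Parseval identity then applies.
  have e : ∀ M N : Cl n, inner ℝ (blade A) (M * rev N) = inner ℝ M (blade A * N) := fun M N => by
    rw [real_inner_comm, inner_mul_right_eq, rev_rev]
  simp_rw [e]
  have hbg : MemLp (fun x => blade A * g x) 2 := (mulL n (blade A)).comp_memLp' hg
  rw [← integral_inner_cft hn hf hbg]
  refine integral_congr_ae ?_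
  filter_upwards [cft_continuousLinearMap_comp hn (mulL n (blade A))
    (fun M => by simp [mulL_apply, mul_assoc]) hg] with ω hω
  simp only [mulL_apply] at hω
  rw [hω]

end Transform

/-! ### Rotations -/

section Rotation

variable {n : ℕ}

lemma coe_inv_SO (r : SO n) :
    ((r⁻¹ : SO n) : Matrix (Fin n) (Fin n) ℝ) = (r : Matrix (Fin n) (Fin n) ℝ).transpose := rfl

lemma transpose_mul_self_SO (r : SO n) :
    (r : Matrix (Fin n) (Fin n) ℝ).transpose * (r : Matrix (Fin n) (Fin n) ℝ) = 1 :=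
  (Matrix.mem_orthogonalGroup_iff' _ _).1 (Matrix.mem_specialOrthogonalGroup_iff.1 r.2).1

lemma rot_inv_rot (r : SO n) (x : E n) : rot r⁻¹ (rot r x) = x := by
  ext i
  simp [rot, Matrix.toLpLin_apply, coe_inv_SO, transpose_mul_self_SO]

lemma rot_rot_inv (r : SO n) (x : E n) : rot r (rot r⁻¹ x) = x := by
  simpa using rot_inv_rot r⁻¹ x

lemma inner_rot_left (r : SO n) (x y : E n) : inner ℝ (rot r x) y = inner ℝ x (rot r⁻¹ y) := by
  rw [rot, rot, coe_inv_SO, ← Matrix.conjTranspose_eq_transpose_of_trivial,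
    Matrix.toEuclideanLin_conjTranspose_eq_adjoint, LinearMap.adjoint_inner_right]

lemma norm_rot (r : SO n) (x : E n) : ‖rot r x‖ = ‖x‖ := by
  rw [← sq_eq_sq₀ (norm_nonneg _) (norm_nonneg _), ← real_inner_self_eq_norm_sq, inner_rot_left,
    rot_inv_rot, real_inner_self_eq_norm_sq]

/-- A rotation as a linear isometric equivalence. -/
def rotIso (r : SO n) : E n ≃ₗᵢ[ℝ] E n where
  toLinearEquiv := LinearEquiv.ofLinearMap (Matrix.toEuclideanLin (r : Matrix (Fin n) (Fin n) ℝ))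
    (Matrix.toEuclideanLin ((r⁻¹ : SO n) : Matrix (Fin n) (Fin n) ℝ))
    (LinearMap.ext fun x => rot_rot_inv r x) (LinearMap.ext fun x => rot_inv_rot r x)
  norm_map' := norm_rot r

lemma rot_smul (r : SO n) (c : ℝ) (x : E n) : rot r (c • x) = c • rot r x := map_smul (rotIso r) c x

lemma rot_one (x : E n) : rot (1 : SO n) x = x := by simp [rot]

lemma continuous_rot : Continuous fun p : SO n × E n => rot p.1 p.2 := by
  simp only [rot, Matrix.toLpLin_apply]
  refine (PiLp.continuous_toLp 2 _).comp ?_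
  exact (continuous_subtype_val.comp continuous_fst).matrix_mulVec
    ((PiLp.continuous_ofLp 2 _).comp continuous_snd)

lemma continuous_inv_SO : Continuous fun r : SO n => r⁻¹ :=
  Continuous.subtype_mk (continuous_subtype_val.matrix_transpose) _

/-- Orthogonal matrices have unit columns, hence entries in $[-1,1]$. Compactness makes a Haar
measure finite, so that Tonelli's theorem applies. -/
instance instCompactSpaceSO (n : ℕ) : CompactSpace (SO n) := by
  refine isCompact_iff_compactSpace.1 ?_
  have hK : IsCompact {A : Matrix (Fin n) (Fin n) ℝ | ∀ i j, A i j ∈ Set.Icc (-1 : ℝ) 1} := by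
    have h := isCompact_univ_pi fun _ : Fin n => isCompact_univ_pi fun _ : Fin n =>
      isCompact_Icc (a := (-1 : ℝ)) (b := 1)
    have e : {A : Matrix (Fin n) (Fin n) ℝ | ∀ i j, A i j ∈ Set.Icc (-1 : ℝ) 1} =
        Set.univ.pi fun _ : Fin n => Set.univ.pi fun _ : Fin n => Set.Icc (-1 : ℝ) 1 :=
      Set.ext fun A => ⟨fun hA i _ j _ => hA i j, fun hA i j => hA i trivial j trivial⟩
    rw [e]
    exact h
  refine hK.of_isClosed_subset ?_ ?_
  · have : ((Matrix.specialOrthogonalGroup (Fin n) ℝ : Submonoid _) :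
        Set (Matrix (Fin n) (Fin n) ℝ)) = {A | A.transpose * A = 1} ∩ {A | A.det = 1} := by
      ext A
      rw [SetLike.mem_coe, Matrix.mem_specialOrthogonalGroup_iff, Matrix.mem_orthogonalGroup_iff']
      rfl
    rw [this]
    exact (isClosed_eq (by fun_prop) continuous_const).inter
      (isClosed_eq (by fun_prop) continuous_const)
  · intro A hA i j
    have h := (Matrix.mem_orthogonalGroup_iff' _ _).1
      (Matrix.mem_specialOrthogonalGroup_iff.1 hA).1
    have h1 : ∑ k, A k j * A k j = 1 := by
      simpa [Matrix.mul_apply] using congr($h j j)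
    have h2 : A i j * A i j ≤ ∑ k, A k j * A k j :=
      Finset.single_le_sum (f := fun k => A k j * A k j) (fun _ _ => mul_self_nonneg _)
        (Finset.mem_univ i)
    rw [Set.mem_Icc]
    constructor <;> nlinarith

instance instSecondCountableSO (n : ℕ) : SecondCountableTopology (SO n) := by
  have : SecondCountableTopology (Matrix (Fin n) (Fin n) ℝ) :=
    inferInstanceAs (SecondCountableTopology (Fin n → Fin n → ℝ))
  exact TopologicalSpace.Subtype.secondCountableTopology _

end Rotation

/-! ### Similarities -/

section Similarity

variable {n : ℕ}

/-- The inverse similarity `x ↦ r⁻¹((x - b)/a)`. -/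
def simInv (a : ℝ) (r : SO n) (b x : E n) : E n := rot r⁻¹ (a⁻¹ • (x - b))

/-- The inverse similarity as a homeomorphism. -/
def simInvHomeo {a : ℝ} (ha : a ≠ 0) (r : SO n) (b : E n) : E n ≃ₜ E n :=
  ((Homeomorph.subRight b).trans (Homeomorph.smulOfNeZero a⁻¹ (inv_ne_zero ha))).trans
    (rotIso r⁻¹).toHomeomorph

lemma map_simInv {a : ℝ} (ha : 0 < a) (r : SO n) (b : E n) :
    Measure.map (simInv a r b) volume = ENNReal.ofReal (a ^ n) • (volume : Measure (E n)) := by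
  have h1 : Measure.map (fun x : E n => x - b) volume = volume :=
    (measurePreserving_sub_right volume b).map_eq
  have h2 := Measure.map_addHaar_smul (volume : Measure (E n)) (inv_ne_zero ha.ne')
  have h3 : Measure.map (rotIso r⁻¹) volume = volume := (rotIso r⁻¹).measurePreserving.map_eq
  have e : simInv a r b = rotIso r⁻¹ ∘ (a⁻¹ • ·) ∘ fun x => x - b := rfl
  rw [e, ← Measure.map_map (rotIso r⁻¹).continuous.measurable (by fun_prop),
    ← Measure.map_map (by fun_prop) (by fun_prop), h1, h2, Measure.map_smul, h3]
  simp [abs_of_pos ha]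

lemma quasiMeasurePreserving_simInv {a : ℝ} (ha : 0 < a) (r : SO n) (b : E n) :
    Measure.QuasiMeasurePreserving (simInv a r b) volume volume :=
  ⟨(simInvHomeo ha.ne' r b).continuous.measurable, by
    rw [map_simInv ha]; exact Measure.smul_absolutelyContinuous⟩

lemma eLpNorm_comp_simInv {a : ℝ} (ha : 0 < a) (r : SO n) (b : E n) (u : E n → Cl n) :
    eLpNorm (fun x => u (simInv a r b x)) 2 volume =
      ENNReal.ofReal (a ^ n) ^ (1 / 2 : ℝ) * eLpNorm u 2 volume := by
  have h := (simInvHomeo ha.ne' r b).measurableEmbedding.eLpNorm_map_measure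
    (μ := volume) (g := u) (p := 2)
  change eLpNorm u 2 (Measure.map (simInv a r b) volume) =
    eLpNorm (fun x => u (simInv a r b x)) 2 volume at h
  rw [← h, map_simInv ha, eLpNorm_smul_measure_of_ne_top (by norm_num)]
  simp

lemma integral_comp_simInv {a : ℝ} (ha : 0 < a) (r : SO n) (b : E n) (u : E n → Cl n) :
    ∫ x, u (simInv a r b x) = a ^ n • ∫ x, u x := by
  have h := (simInvHomeo ha.ne' r b).measurableEmbedding.integral_map (μ := volume) u
  change ∫ x, u x ∂(Measure.map (simInv a r b) volume) = ∫ x, u (simInv a r b x) at h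
  rw [← h, map_simInv ha, integral_smul_measure, ENNReal.toReal_ofReal (by positivity)]

lemma integrable_comp_simInv {a : ℝ} (ha : 0 < a) (r : SO n) (b : E n) {u : E n → Cl n}
    (hu : Integrable u) : Integrable fun x => u (simInv a r b x) := by
  have h : Integrable u (Measure.map (simInvHomeo ha.ne' r b) volume) := by
    change Integrable u (Measure.map (simInv a r b) volume)
    rw [map_simInv ha]
    exact hu.smul_measure ENNReal.ofReal_ne_top
  exact (simInvHomeo ha.ne' r b).measurableEmbedding.integrable_map_iff.1 h

/-- The map on the Fourier side is again an inverse similarity, with dilation $a^{-1}$ and no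
translation, so the change-of-variables lemmas serve both sides. -/
lemma dil_rot_eq_simInv (a : ℝ) (r : SO n) (ω : E n) :
    a • rot r⁻¹ ω = simInv a⁻¹ r 0 ω := by
  rw [simInv, sub_zero, inv_inv, rot_smul]

lemma daughter_eq (ψ : E n → Cl n) (a : ℝ) (r : SO n) (b : E n) :
    daughter ψ a r b = (1 / a ^ ((n : ℝ) / 2)) • fun x => ψ (simInv a r b x) := rfl

lemma memLp_comp_simInv {a : ℝ} (ha : 0 < a) (r : SO n) (b : E n) {u : E n → Cl n}
    (hu : MemLp u 2) : MemLp (fun x => u (simInv a r b x)) 2 :=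
  ⟨hu.1.comp_quasiMeasurePreserving (quasiMeasurePreserving_simInv ha r b), by
    rw [eLpNorm_comp_simInv ha]
    exact ENNReal.mul_lt_top (ENNReal.rpow_lt_top_of_nonneg (by norm_num) ENNReal.ofReal_ne_top)
      hu.2⟩

lemma memLp_daughter {ψ : E n → Cl n} (hψ : MemLp ψ 2) {a : ℝ} (ha : 0 < a) (r : SO n) (b : E n) :
    MemLp (daughter ψ a r b) 2 := by
  rw [daughter_eq]
  exact (memLp_comp_simInv ha r b hψ).const_smul _

lemma memLp_dil_rot {g : E n → Cl n} (hg : MemLp g 2) {a : ℝ} (ha : 0 < a) (r : SO n) :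
    MemLp (fun ω => g (a • rot r⁻¹ ω)) 2 := by
  simp_rw [dil_rot_eq_simInv]
  exact memLp_comp_simInv (inv_pos.2 ha) r 0 hg

/-- Splits the phase into the one seen by the mother wavelet, at frequency $a r^{-1}\omega$, and the
one due to the translation $b$. -/
lemma inner_eq_simInv {a : ℝ} (ha : a ≠ 0) (r : SO n) (b ω x : E n) :
    inner ℝ ω x = inner ℝ (a • rot r⁻¹ ω) (simInv a r b x) + inner ℝ ω b := by
  rw [simInv, inner_smul_left, inner_rot_left, inv_inv, rot_rot_inv, inner_smul_right,
    inner_sub_right]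
  simp
  field_simp
  ring

lemma one_div_rpow_half_mul_pow {a : ℝ} (ha : 0 < a) :
    1 / a ^ ((n : ℝ) / 2) * a ^ n = a ^ ((n : ℝ) / 2) := by
  rw [one_div, inv_mul_eq_iff_eq_mul₀ (by positivity), ← Real.rpow_add ha, add_halves,
    Real.rpow_natCast]

/-- The transformation on the Fourier side that corresponds to `daughter`. -/
def fourierDaughter (u : E n → Cl n) (a : ℝ) (r : SO n) (b : E n) (ω : E n) : Cl n :=
  (a ^ ((n : ℝ) / 2) • u (a • rot r⁻¹ ω)) * expI n (-(inner ℝ ω b))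

lemma integrable_daughter {u : E n → Cl n} (hu : Integrable u) {a : ℝ} (ha : 0 < a) (r : SO n)
    (b : E n) : Integrable (daughter u a r b) := by
  rw [daughter_eq]
  exact (integrable_comp_simInv ha r b hu).smul _

lemma eLpNorm_daughter (u : E n → Cl n) {a : ℝ} (ha : 0 < a) (r : SO n) (b : E n) :
    eLpNorm (daughter u a r b) 2 volume =
      ‖1 / a ^ ((n : ℝ) / 2)‖ₑ * ENNReal.ofReal (a ^ n) ^ (1 / 2 : ℝ) * eLpNorm u 2 volume := by
  rw [daughter_eq, eLpNorm_const_smul, eLpNorm_comp_simInv ha, mul_assoc]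

lemma aestronglyMeasurable_fourierDaughter {u : E n → Cl n} (hu : AEStronglyMeasurable u) {a : ℝ}
    (ha : 0 < a) (r : SO n) (b : E n) : AEStronglyMeasurable (fourierDaughter u a r b) := by
  have h1 : AEStronglyMeasurable (fun ω => u (a • rot r⁻¹ ω)) := by
    simp_rw [dil_rot_eq_simInv]
    exact hu.comp_quasiMeasurePreserving (quasiMeasurePreserving_simInv (inv_pos.2 ha) r 0)
  have h2 : Continuous fun ω : E n => expI n (-(inner ℝ ω b)) := by fun_prop
  exact (h1.const_smul (a ^ ((n : ℝ) / 2))).mul h2.aestronglyMeasurable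

lemma eLpNorm_fourierDaughter (hn : n % 4 = 2 ∨ n % 4 = 3) (u : E n → Cl n) {a : ℝ} (ha : 0 < a)
    (r : SO n) (b : E n) : eLpNorm (fourierDaughter u a r b) 2 volume =
      ‖a ^ ((n : ℝ) / 2)‖ₑ * ENNReal.ofReal (a⁻¹ ^ n) ^ (1 / 2 : ℝ) * eLpNorm u 2 volume := by
  rw [mul_assoc, ← eLpNorm_comp_simInv (inv_pos.2 ha) r 0, ← eLpNorm_const_smul]
  refine eLpNorm_congr_norm_ae (ae_of_all _ fun ω => ?_)
  rw [fourierDaughter, norm_mul_expI hn, dil_rot_eq_simInv, Pi.smul_apply]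

lemma cftIntegral_daughter (hn : n % 4 = 2 ∨ n % 4 = 3) {u : E n → Cl n} (hu : Integrable u) {a : ℝ}
    (ha : 0 < a) (r : SO n) (b : E n) :
    cftIntegral (daughter u a r b) = fourierDaughter (cftIntegral u) a r b := by
  ext ω
  rw [cftIntegral_eq_integral hn (integrable_daughter hu ha r b)]
  have h := integral_comp_simInv ha r b fun y => (1 / a ^ ((n : ℝ) / 2)) •
    ((u y * expI n (-(inner ℝ (a • rot r⁻¹ ω) y))) * expI n (-(inner ℝ ω b)))
  have e : ∀ x, daughter u a r b x * expI n (-(inner ℝ ω x)) = (1 / a ^ ((n : ℝ) / 2)) •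
      ((u (simInv a r b x) * expI n (-(inner ℝ (a • rot r⁻¹ ω) (simInv a r b x)))) *
        expI n (-(inner ℝ ω b))) := fun x => by
    rw [inner_eq_simInv ha.ne' r b ω x, neg_add, expI_add hn, daughter_eq, Pi.smul_apply,
      smul_mul_assoc, ← mul_assoc]
  refine (integral_congr_ae (ae_of_all _ e)).trans (h.trans ?_)
  rw [integral_smul, smul_smul, mul_comm, one_div_rpow_half_mul_pow ha,
    fourierDaughter, cftIntegral_eq_integral hn hu, smul_mul_assoc]
  congr 1
  exact ((mulL n).flip (expI n (-(inner ℝ ω b)))).integral_comp_comm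
    (integrable_mul_expI hn hu (by fun_prop))

/-- The Clifford Fourier transform of a daughter wavelet. -/
lemma cft_daughter (hn : n % 4 = 2 ∨ n % 4 = 3) {ψ : E n → Cl n} (hψ : MemLp ψ 2) {a : ℝ}
    (ha : 0 < a) (r : SO n) (b : E n) :
    cft (daughter ψ a r b) =ᵐ[volume] fourierDaughter (cft ψ) a r b := by
  have hC : ∀ s t : ℝ, ‖s‖ₑ * ENNReal.ofReal t ^ (1 / 2 : ℝ) ≠ ⊤ := fun s t =>
    ENNReal.mul_ne_top enorm_ne_top
      (ENNReal.rpow_lt_top_of_nonneg (by norm_num) ENNReal.ofReal_ne_top).ne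
  refine cft_intertwine hn (S := fun u => daughter u a r b)
    (S' := fun u => fourierDaughter u a r b) (hC _ _) (hC _ _) ?_ ?_ ?_
    (fun u hu => aestronglyMeasurable_fourierDaughter hu ha r b)
    (fun u hu => (eLpNorm_daughter u ha r b).le)
    (fun u hu => (eLpNorm_fourierDaughter hn u ha r b).le)
    (fun u hu => integrable_daughter hu ha r b)
    (fun u hu => cftIntegral_daughter hn hu ha r b) hψ
  · intro u v; ext x; simp [daughter_eq, smul_sub]
  · intro u v; ext x; simp [fourierDaughter, smul_sub, sub_mul]
  · intro u hu
    simp only [daughter_eq]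
    exact (hu.comp_quasiMeasurePreserving (quasiMeasurePreserving_simInv ha r b)).const_smul _

end Similarity

/-! ### The wavelet transform on the Fourier side -/

section Wavelet

variable {n : ℕ}

/-- The Clifford Fourier transform preserves the commutation rule with the pseudoscalar. -/
lemma pseudoscalar_mul_cft (hn : n % 4 = 2 ∨ n % 4 = 3) {σ : ℝ} {ψ : E n → Cl n} (hψ : MemLp ψ 2)
    (h : ∀ᵐ x, pseudoscalar n * ψ x = σ • (ψ x * pseudoscalar n)) :
    ∀ᵐ ω, pseudoscalar n * cft ψ ω = σ • (cft ψ ω * pseudoscalar n) := by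
  -- Both sides of the commutation rule are maps of $\psi$ that commute with right multiplication by
  -- $i_n$, so both pass through the transform.
  have h1 := cft_continuousLinearMap_comp hn (mulL n (pseudoscalar n))
    (fun M => by simp [mulL_apply, mul_assoc]) hψ
  have h2 := cft_continuousLinearMap_comp hn (σ • (mulL n).flip (pseudoscalar n))
    (fun M => by simp [mulL_apply]) hψ
  have h3 : cft (fun x => mulL n (pseudoscalar n) (ψ x)) =
      cft fun x => (σ • (mulL n).flip (pseudoscalar n)) (ψ x) := by
    refine cft_congr_ae ?_
    filter_upwards [h] with x hx
    simpa [mulL_apply] using hx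
  rw [h3] at h1
  filter_upwards [h1, h2] with ω h1 h2
  rw [h1] at h2
  simpa [mulL_apply] using h2

lemma exists_pseudoscalar_mul (hn : n % 4 = 2 ∨ n % 4 = 3) {ψ : E n → Cl n}
    (hψ : n % 4 = 2 → (∀ᵐ x, ψ x ∈ CliffordAlgebra.evenOdd (euclideanForm n) 0) ∨
      (∀ᵐ x, ψ x ∈ CliffordAlgebra.evenOdd (euclideanForm n) 1)) :
    ∃ σ : ℝ, (σ = 1 ∨ σ = -1) ∧
      ∀ᵐ x, pseudoscalar n * ψ x = σ • (ψ x * pseudoscalar n) := by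
  rcases hn with hn | hn
  · rcases hψ hn with h | h
    · refine ⟨1, Or.inl rfl, ?_⟩
      filter_upwards [h] with x hx
      rw [pseudoscalar_mul_of_even hn, CliffordAlgebra.involute_eq_of_mem_even hx, one_smul]
    · refine ⟨-1, Or.inr rfl, ?_⟩
      filter_upwards [h] with x hx
      rw [pseudoscalar_mul_of_even hn, CliffordAlgebra.involute_eq_of_mem_odd hx, neg_one_smul,
        neg_mul]
  · refine ⟨1, Or.inl rfl, ae_of_all _ fun x => ?_⟩
    rw [pseudoscalar_mul_of_odd (by omega), one_smul]

/-- The reverse would leave the exponential on the left of $\widetilde M$. Moving it past $M$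
beforehand, at the price of the sign $\sigma$ in the phase, puts it on the right, where the Fourier
kernel stands. -/
lemma rev_mul_expI (hn : n % 4 = 2 ∨ n % 4 = 3) {σ : ℝ} (hσ : σ = 1 ∨ σ = -1) {M : Cl n}
    (h : pseudoscalar n * M = σ • (M * pseudoscalar n)) (t : ℝ) :
    rev (M * expI n (-t)) = rev M * expI n (σ * t) := by
  have h' : M * pseudoscalar n = σ • (pseudoscalar n * M) := by
    rw [h, smul_smul]
    rcases hσ with rfl | rfl <;> simp
  have e : M * expI n (-t) = expI n (-(σ * t)) * M := by
    rw [expI, expI, mul_add, add_mul, mul_smul_comm, smul_mul_assoc, h', smul_smul,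
      ← Algebra.commutes]
    rcases hσ with rfl | rfl <;> simp
  rw [e, rev_mul, rev_expI hn, neg_neg]

/-- The Fourier transform of the wavelet transform in the translation variable, at dilation `a`
and rotation `r`. -/
def waveletSymbol (ψ f : E n → Cl n) (p : ℝ × SO n) (ω : E n) : Cl n :=
  cft f ω * rev (p.1 ^ ((n : ℝ) / 2) • cft ψ (p.1 • rot p.2⁻¹ ω))

lemma memLp_rev {α : Type*} [MeasurableSpace α] {μ : Measure α} {u : α → Cl n} (hu : MemLp u 2 μ) :
    MemLp (fun x => rev (u x)) 2 μ := (revL n).comp_memLp' hu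

lemma waveletTransform_eq_integral {ψ f : E n → Cl n} (hψ : MemLp ψ 2) (hf : MemLp f 2)
    {p : (ℝ × SO n) × E n} (hp : 0 < p.1.1) :
    waveletTransform ψ f p = ∫ x, f x * rev (daughter ψ p.1.1 p.1.2 p.2 x) :=
  clIntegral_eq_integral (integrable_mul_of_memLp hf (memLp_rev (memLp_daughter hψ hp _ _)))

lemma integrable_waveletSymbol (hn : n % 4 = 2 ∨ n % 4 = 3) {ψ f : E n → Cl n} (hψ : MemLp ψ 2)
    (hf : MemLp f 2) {p : ℝ × SO n} (hp : 0 < p.1) : Integrable (waveletSymbol ψ f p) :=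
  integrable_mul_of_memLp (memLp_cft hn hf)
    (memLp_rev ((memLp_dil_rot (memLp_cft hn hψ) hp p.2).const_smul (p.1 ^ ((n : ℝ) / 2))))

/-- By Parseval, $b$ enters only through the phase of the transformed daughter wavelet, and this
phase is a Fourier kernel evaluated at $-\sigma b$. -/
lemma waveletTransform_eq_cftIntegral (hn : n % 4 = 2 ∨ n % 4 = 3) {σ : ℝ} (hσ : σ = 1 ∨ σ = -1)
    {ψ f : E n → Cl n} (hψ : MemLp ψ 2)
    (h : ∀ᵐ x, pseudoscalar n * ψ x = σ • (ψ x * pseudoscalar n)) (hf : MemLp f 2)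
    {p : ℝ × SO n} (hp : 0 < p.1) (b : E n) :
    waveletTransform ψ f (p, b) =
      ((2 * Real.pi) ^ n)⁻¹ • cftIntegral (waveletSymbol ψ f p) (-σ • b) := by
  have hpi : (2 * Real.pi) ^ n ≠ 0 := by positivity
  rw [waveletTransform_eq_integral hψ hf hp, eq_inv_smul_iff₀ hpi,
    ← integral_cft_mul_rev_cft hn hf (memLp_daughter hψ hp _ _),
    cftIntegral_eq_integral hn (integrable_waveletSymbol hn hψ hf hp)]
  refine integral_congr_ae ?_
  have h1 : ∀ᵐ ω, pseudoscalar n * cft ψ (p.1 • rot p.2⁻¹ ω) =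
      σ • (cft ψ (p.1 • rot p.2⁻¹ ω) * pseudoscalar n) := by
    simp_rw [dil_rot_eq_simInv]
    exact (quasiMeasurePreserving_simInv (inv_pos.2 hp) p.2 0).ae (pseudoscalar_mul_cft hn hψ h)
  filter_upwards [cft_daughter hn hψ hp p.2 b, h1] with ω hω h1
  rw [hω, fourierDaughter, rev_mul_expI hn hσ, waveletSymbol, mul_assoc]
  · rw [inner_smul_left, real_inner_comm]
    simp
  · rw [mul_smul_comm, h1, smul_mul_assoc, smul_comm]

lemma normSq_const_smul {α : Type*} [MeasurableSpace α] (μ : Measure α) (k : ℝ) (u : α → Cl n) :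
    normSq μ (fun x => k • u x) = ‖k‖ₑ ^ 2 * normSq μ u := by
  rw [normSq_eq_lintegral, normSq_eq_lintegral,
    ← lintegral_const_mul' _ _ (ENNReal.pow_ne_top enorm_ne_top)]
  simp_rw [enorm_smul, mul_pow]

lemma normSq_waveletTransform_section (hn : n % 4 = 2 ∨ n % 4 = 3) {σ : ℝ} (hσ : σ = 1 ∨ σ = -1)
    {ψ f : E n → Cl n} (hψ : MemLp ψ 2)
    (h : ∀ᵐ x, pseudoscalar n * ψ x = σ • (ψ x * pseudoscalar n)) (hf : MemLp f 2)
    {p : ℝ × SO n} (hp : 0 < p.1) (hs : MemLp (waveletSymbol ψ f p) 2) :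
    normSq volume (fun b => waveletTransform ψ f (p, b)) =
      ENNReal.ofReal ((2 * Real.pi) ^ n)⁻¹ * normSq volume (waveletSymbol ψ f p) := by
  -- Since $\sigma=\pm1$, the argument is at most reflected, which preserves Lebesgue measure.
  have h1 : normSq volume (fun b => cftIntegral (waveletSymbol ψ f p) (-σ • b)) =
      normSq volume (cftIntegral (waveletSymbol ψ f p)) := by
    rcases hσ with rfl | rfl
    · simp_rw [normSq_eq_lintegral, neg_one_smul]
      exact lintegral_neg_eq_self (fun b => ‖cftIntegral (waveletSymbol ψ f p) b‖ₑ ^ 2)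
    · simp
  simp_rw [waveletTransform_eq_cftIntegral hn hσ hψ h hf hp]
  have h2 : normSq volume (fun b =>
      ((2 * Real.pi) ^ n)⁻¹ • cftIntegral (waveletSymbol ψ f p) (-σ • b)) =
      ENNReal.ofReal ((2 * Real.pi) ^ n)⁻¹ ^ 2 *
        normSq volume (fun b => cftIntegral (waveletSymbol ψ f p) (-σ • b)) := by
    rw [normSq_const_smul, Real.enorm_of_nonneg (by positivity)]
  rw [h2, h1, normSq_cftIntegral hn (integrable_waveletSymbol hn hψ hf hp) hs, ← mul_assoc, sq,
    mul_assoc (ENNReal.ofReal _), ← ENNReal.ofReal_mul (by positivity),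
    inv_mul_cancel₀ (by positivity), ENNReal.ofReal_one, mul_one]

/-! ### The similitude group -/

variable {ν : Measure (SO n)}

instance instSFiniteDilRot [SFinite ν] : SFinite (dilRotMeasure ν) := by
  unfold dilRotMeasure; infer_instance

lemma ae_dilRotMeasure_pos [SFinite ν] : ∀ᵐ p ∂(dilRotMeasure ν), 0 < p.1 := by
  have h : ∀ᵐ a ∂((volume.restrict (Set.Ioi (0 : ℝ))).withDensity
      fun a => ENNReal.ofReal (1 / a ^ (n + 1))), 0 < a :=
    (withDensity_absolutelyContinuous _ _).ae_le (ae_restrict_mem measurableSet_Ioi)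
  exact Measure.quasiMeasurePreserving_fst.ae h

lemma ae_simMeasure_pos [SFinite ν] : ∀ᵐ p ∂(simMeasure ν), 0 < p.1.1 :=
  Measure.quasiMeasurePreserving_fst.ae ae_dilRotMeasure_pos

lemma measurable_rot_comp {α : Type*} [MeasurableSpace α] {g : α → SO n} {h : α → E n}
    (hg : Measurable g) (hh : Measurable h) : Measurable fun q => rot (g q) (h q) := by
  have h3 := (continuous_rot (n := n)).measurable.comp (hg.prodMk hh)
  exact h3

lemma measurable_simInv :
    Measurable fun q : ((ℝ × SO n) × E n) × E n => simInv q.1.1.1 q.1.1.2 q.1.2 q.2 := by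
  have h1 : Measurable fun q : ((ℝ × SO n) × E n) × E n => (q.1.1.2)⁻¹ :=
    continuous_inv_SO.measurable.comp (measurable_snd.comp (measurable_fst.comp measurable_fst))
  have h2 : Measurable fun q : ((ℝ × SO n) × E n) × E n => q.1.1.1⁻¹ • (q.2 - q.1.2) :=
    (measurable_fst.comp (measurable_fst.comp measurable_fst)).inv.smul
      (measurable_snd.sub (measurable_snd.comp measurable_fst))
  exact measurable_rot_comp h1 h2

/-- The wavelet is only almost everywhere measurable, so its composition with the group action is
controlled only if null sets pull back to null sets. -/
lemma quasiMeasurePreserving_simInv_prod [SFinite ν] :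
    Measure.QuasiMeasurePreserving
      (fun q : ((ℝ × SO n) × E n) × E n => simInv q.1.1.1 q.1.1.2 q.1.2 q.2)
      ((simMeasure ν).prod volume) volume := by
  refine QuasiMeasurePreserving.prod_of_right measurable_simInv ?_
  filter_upwards [ae_simMeasure_pos] with p hp
  exact quasiMeasurePreserving_simInv hp _ _

lemma quasiMeasurePreserving_dil_rot [SFinite ν] :
    Measure.QuasiMeasurePreserving (fun q : (ℝ × SO n) × E n => q.1.1 • rot q.1.2⁻¹ q.2)
      ((dilRotMeasure ν).prod volume) volume := by
  refine QuasiMeasurePreserving.prod_of_right ?_ ?_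
  · have h1 : Measurable fun q : (ℝ × SO n) × E n => (q.1.2)⁻¹ :=
      continuous_inv_SO.measurable.comp (measurable_snd.comp measurable_fst)
    have h2 : Measurable fun q : (ℝ × SO n) × E n => rot (q.1.2)⁻¹ q.2 :=
      measurable_rot_comp h1 measurable_snd
    exact (measurable_fst.comp measurable_fst).smul h2
  · filter_upwards [ae_dilRotMeasure_pos] with p hp
    simp_rw [dil_rot_eq_simInv]
    exact quasiMeasurePreserving_simInv (inv_pos.2 hp) _ _

lemma aestronglyMeasurable_waveletTransform [SFinite ν] {ψ f : E n → Cl n} (hψ : MemLp ψ 2)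
    (hf : MemLp f 2) : AEStronglyMeasurable (waveletTransform ψ f) (simMeasure ν) := by
  have h1 : AEStronglyMeasurable (fun q : ((ℝ × SO n) × E n) × E n =>
      f q.2 * rev (daughter ψ q.1.1.1 q.1.1.2 q.1.2 q.2)) ((simMeasure ν).prod volume) := by
    refine (hf.1.comp_quasiMeasurePreserving Measure.quasiMeasurePreserving_snd).mul
      (continuous_rev.comp_aestronglyMeasurable ?_)
    refine AEStronglyMeasurable.smul (f := fun q : ((ℝ × SO n) × E n) × E n =>
      1 / q.1.1.1 ^ ((n : ℝ) / 2)) ?_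
      (hψ.1.comp_quasiMeasurePreserving quasiMeasurePreserving_simInv_prod)
    exact Measurable.aestronglyMeasurable (by fun_prop)
  refine h1.integral_prod_right'.congr ?_
  filter_upwards [ae_simMeasure_pos] with p hp
  exact (waveletTransform_eq_integral hψ hf hp).symm

lemma aestronglyMeasurable_waveletSymbol [SFinite ν] (hn : n % 4 = 2 ∨ n % 4 = 3) {ψ f : E n → Cl n}
    (hψ : MemLp ψ 2) (hf : MemLp f 2) :
    AEStronglyMeasurable (fun q : (ℝ × SO n) × E n => waveletSymbol ψ f q.1 q.2)
      ((dilRotMeasure ν).prod volume) := by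
  refine ((memLp_cft hn hf).1.comp_quasiMeasurePreserving Measure.quasiMeasurePreserving_snd).mul
    (continuous_rev.comp_aestronglyMeasurable ?_)
  refine AEStronglyMeasurable.smul (f := fun q : (ℝ × SO n) × E n => q.1.1 ^ ((n : ℝ) / 2)) ?_
    ((memLp_cft hn hψ).1.comp_quasiMeasurePreserving quasiMeasurePreserving_dil_rot)
  exact Measurable.aestronglyMeasurable (by fun_prop)

/-- The adjoint of right multiplication by $\widetilde N$ is right multiplication by $N$, so the
product $\widetilde N N$ of the admissibility condition appears. -/
lemma norm_waveletSymbol_sq {ψ f : E n → Cl n} {p : ℝ × SO n} (hp : 0 < p.1) (ω : E n) :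
    ‖waveletSymbol ψ f p ω‖ ^ 2 =
      inner ℝ (cft f ω) (cft f ω * admissibilityIntegrand ψ ω p) := by
  have ha : p.1 ^ ((n : ℝ) / 2) * p.1 ^ ((n : ℝ) / 2) = p.1 ^ n := by
    rw [← Real.rpow_add hp, add_halves, Real.rpow_natCast]
  rw [← real_inner_self_eq_norm_sq, waveletSymbol, inner_mul_right_eq, rev_rev, mul_assoc, rev_smul,
    smul_mul_smul_comm, ha, admissibilityIntegrand]

lemma lintegral_waveletSymbol [SFinite ν] {ψ : E n → Cl n} (f : E n → Cl n) {c : ℝ} {ω : E n}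
    (hi : ClIntegrable (dilRotMeasure ν) (admissibilityIntegrand ψ ω))
    (hc : clIntegral (dilRotMeasure ν) (admissibilityIntegrand ψ ω) = algebraMap ℝ (Cl n) c) :
    ∫⁻ p, ‖waveletSymbol ψ f p ω‖ₑ ^ 2 ∂(dilRotMeasure ν) =
      ENNReal.ofReal c * ‖cft f ω‖ₑ ^ 2 := by
  rw [clIntegrable_iff] at hi
  rw [clIntegral_eq_integral hi] at hc
  set ℓ : Cl n →L[ℝ] ℝ := (innerSL ℝ (cft f ω)).comp (mulL n (cft f ω)) with hℓ
  have hℓa : ∀ M, ℓ M = inner ℝ (cft f ω) (cft f ω * M) := fun M => rfl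
  have h1 : ∀ᵐ p ∂(dilRotMeasure ν),
      ‖waveletSymbol ψ f p ω‖ ^ 2 = ℓ (admissibilityIntegrand ψ ω p) := by
    filter_upwards [ae_dilRotMeasure_pos] with p hp
    rw [norm_waveletSymbol_sq hp, hℓa]
  have h2 : ∫ p, ℓ (admissibilityIntegrand ψ ω p) ∂(dilRotMeasure ν) = c * ‖cft f ω‖ ^ 2 := by
    -- Here it matters that the admissibility constant is a scalar: it can be pulled out of the
    -- inner product.
    rw [ℓ.integral_comp_comm hi, hc, hℓa, ← Algebra.commutes, ← Algebra.smul_def, inner_smul_right,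
      real_inner_self_eq_norm_sq]
  have h3 : ∫⁻ p, ‖waveletSymbol ψ f p ω‖ₑ ^ 2 ∂(dilRotMeasure ν) =
      ∫⁻ p, ENNReal.ofReal (ℓ (admissibilityIntegrand ψ ω p)) ∂(dilRotMeasure ν) := by
    refine lintegral_congr_ae ?_
    filter_upwards [h1] with p hp
    rw [← hp, ENNReal.ofReal_pow (norm_nonneg _), ofReal_norm]
  rw [h3, ← ofReal_integral_eq_lintegral_ofReal (ℓ.integrable_comp hi), h2,
    ENNReal.ofReal_mul' (by positivity), ENNReal.ofReal_pow (norm_nonneg _), ofReal_norm]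
  filter_upwards [h1] with p hp
  rw [← hp]
  exact sq_nonneg _

/-- The wavelet transform is an isometry up to the admissibility constant. -/
theorem normSq_waveletTransform [SFinite ν] (hn : n % 4 = 2 ∨ n % 4 = 3) {ψ : E n → Cl n} {c : ℝ}
    (hψ : IsAdmissible ν ψ (algebraMap ℝ (Cl n) c)) {f : E n → Cl n} (hf : MemLp f 2) :
    normSq (simMeasure ν) (waveletTransform ψ f) = ENNReal.ofReal c * normSq volume f := by
  have hψ2 : MemLp ψ 2 := memL2_iff.1 hψ.memL2
  obtain ⟨σ, hσ, hcomm⟩ := exists_pseudoscalar_mul hn hψ.parity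
  have hsm := aestronglyMeasurable_waveletSymbol (ν := ν) hn hψ2 hf
  have hsm2 : AEMeasurable (fun q : (ℝ × SO n) × E n => ‖waveletSymbol ψ f q.1 q.2‖ₑ ^ 2)
      ((dilRotMeasure ν).prod volume) := hsm.enorm.pow_const 2
  have htotal : ∫⁻ p, (∫⁻ ω, ‖waveletSymbol ψ f p ω‖ₑ ^ 2) ∂(dilRotMeasure ν) =
      ENNReal.ofReal c * normSq volume (cft f) := by
    rw [lintegral_lintegral_swap hsm2, normSq_eq_lintegral, ← lintegral_const_mul'' _
      ((memLp_cft hn hf).1.enorm.pow_const 2)]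
    refine lintegral_congr_ae ?_
    filter_upwards [hψ.finite_const] with ω hω
    exact lintegral_waveletSymbol f hω.1 hω.2
  -- The finite total makes almost every section square-integrable, as Plancherel in the variable
  -- $b$ requires.
  have hfin : ∀ᵐ p ∂(dilRotMeasure ν), ∫⁻ ω, ‖waveletSymbol ψ f p ω‖ₑ ^ 2 < ⊤ := by
    refine ae_lt_top' hsm2.lintegral_prod_right' ?_
    rw [htotal]
    refine ENNReal.mul_ne_top ENNReal.ofReal_ne_top ?_
    rw [normSq_eq_eLpNorm_sq]
    exact ENNReal.pow_ne_top (memLp_cft hn hf).2.ne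
  have hsec : ∀ᵐ p ∂(dilRotMeasure ν), ∫⁻ b, ‖waveletTransform ψ f (p, b)‖ₑ ^ 2 =
      ENNReal.ofReal ((2 * Real.pi) ^ n)⁻¹ * ∫⁻ ω, ‖waveletSymbol ψ f p ω‖ₑ ^ 2 := by
    filter_upwards [hfin, ae_dilRotMeasure_pos] with p hp hpos
    have hs : MemLp (waveletSymbol ψ f p) 2 := by
      refine ⟨(integrable_waveletSymbol hn hψ2 hf hpos).1, ?_⟩
      rw [← eLpNorm_two_sq] at hp
      exact lt_top_iff_ne_top.2 fun h => by simp [h] at hp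
    have := normSq_waveletTransform_section hn hσ hψ2 hcomm hf hpos hs
    rwa [normSq_eq_lintegral, normSq_eq_lintegral] at this
  rw [normSq_eq_lintegral, simMeasure, lintegral_prod _
    ((aestronglyMeasurable_waveletTransform hψ2 hf).enorm.pow_const 2), lintegral_congr_ae hsec,
    lintegral_const_mul'' _ hsm2.lintegral_prod_right', htotal, normSq_cft hn hf, mul_left_comm,
    ← mul_assoc (ENNReal.ofReal _⁻¹), ← ENNReal.ofReal_mul (by positivity),
    inv_mul_cancel₀ (by positivity), ENNReal.ofReal_one, one_mul]

end Wavelet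

/-! ### Translations -/

section Translation

variable {n : ℕ}

lemma cft_sub (hn : n % 4 = 2 ∨ n % 4 = 3) {f g : E n → Cl n} (hf : MemLp f 2)
    (hg : MemLp g 2) : cft (f - g) =ᵐ[volume] cft f - cft g := by
  have h := cft_add hn (hf.sub hg) hg
  rw [sub_add_cancel] at h
  filter_upwards [h] with ω hω
  rw [Pi.sub_apply, hω, Pi.add_apply, add_sub_cancel_right]

lemma memLp_translate {f : E n → Cl n} (hf : MemLp f 2) (v : E n) : MemLp (fun x => f (x + v)) 2 :=
  hf.comp_measurePreserving (measurePreserving_add_right volume v)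

/-- A translate is the daughter function with dilation 1, trivial rotation and shift $-v$. -/
lemma cft_translate (hn : n % 4 = 2 ∨ n % 4 = 3) {f : E n → Cl n} (hf : MemLp f 2) (v : E n) :
    cft (fun x => f (x + v)) =ᵐ[volume] fun ω => cft f ω * expI n (inner ℝ ω v) := by
  have h := cft_daughter hn hf one_pos 1 (-v)
  have e : daughter f 1 1 (-v) = fun x => f (x + v) := by
    ext x; simp [daughter, rot_one]
  have e' : fourierDaughter (cft f) 1 1 (-v) = fun ω => cft f ω * expI n (inner ℝ ω v) := by
    ext ω; simp [fourierDaughter, rot_one]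
  rwa [e, e'] at h

/-- Right multiplication by $i_n$ is skew, so $M$ and $Mi_n$ are orthogonal and the left side equals
$(2-2\cos(s-t))|M|^2$. -/
lemma norm_mul_expI_sub_sq_le (hn : n % 4 = 2 ∨ n % 4 = 3) (M : Cl n) (s t : ℝ) :
    ‖M * expI n s - M * expI n t‖ ^ 2 ≤ (s - t) ^ 2 * ‖M‖ ^ 2 := by
  have h0 : inner ℝ (M * pseudoscalar n) M = 0 := by
    have h := inner_mul_right_eq M (pseudoscalar n) M
    rw [rev_pseudoscalar hn, mul_neg, inner_neg_right, real_inner_comm] at h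
    rw [real_inner_comm]
    linarith
  have h1 : inner ℝ (M * expI n s) (M * expI n t) = Real.cos (s - t) * ‖M‖ ^ 2 := by
    rw [real_inner_comm, inner_mul_right_eq, real_inner_comm, rev_expI hn, mul_assoc,
      ← expI_add hn, ← sub_eq_add_neg, expI, mul_add, mul_smul_comm, inner_add_left,
      inner_smul_left, h0, ← Algebra.commutes, ← Algebra.smul_def, inner_smul_left,
      real_inner_self_eq_norm_sq]
    simp
  rw [norm_sub_sq_real, norm_mul_expI hn, norm_mul_expI hn, h1]
  nlinarith [Real.one_sub_sq_div_two_le_cos (x := s - t), sq_nonneg ‖M‖]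

lemma normSq_translate_sub_le (hn : n % 4 = 2 ∨ n % 4 = 3) {f : E n → Cl n} (hf : MemLp f 2)
    (v w : E n) :
    normSq volume ((fun x => f (x + v)) - fun x => f (x + w)) ≤
      ENNReal.ofReal ((2 * Real.pi) ^ n)⁻¹ *
        ∫⁻ ω, ‖inner ℝ ω (v - w) • cft f ω‖ₑ ^ 2 := by
  have hv := memLp_translate hf v
  have hw := memLp_translate hf w
  have h1 := normSq_cft hn (hv.sub hw)
  have h2 : normSq volume ((fun x => f (x + v)) - fun x => f (x + w)) =
      ENNReal.ofReal ((2 * Real.pi) ^ n)⁻¹ *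
        normSq volume (cft ((fun x => f (x + v)) - fun x => f (x + w))) := by
    rw [h1, ← mul_assoc, ← ENNReal.ofReal_mul (by positivity), inv_mul_cancel₀ (by positivity),
      ENNReal.ofReal_one, one_mul]
  rw [h2, normSq_eq_lintegral]
  refine mul_le_mul_right (lintegral_mono_ae ?_) _
  filter_upwards [cft_sub hn hv hw, cft_translate hn hf v, cft_translate hn hf w] with ω h3 h4 h5
  rw [h3, Pi.sub_apply, h4, h5, ← ofReal_norm, ← ofReal_norm,
    ← ENNReal.ofReal_pow (norm_nonneg _), ← ENNReal.ofReal_pow (norm_nonneg _)]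
  refine ENNReal.ofReal_le_ofReal ((norm_mul_expI_sub_sq_le hn _ _ _).trans_eq ?_)
  rw [norm_smul, mul_pow, inner_sub_right, Real.norm_eq_abs, sq_abs]

lemma waveletTransform_add_right (ψ f : E n → Cl n) (p : ℝ × SO n) (b v : E n) :
    waveletTransform ψ f (p, b + v) = waveletTransform ψ (fun x => f (x + v)) (p, b) := by
  unfold waveletTransform clIntegral
  refine Finset.sum_congr rfl fun A _ => ?_
  congr 1
  rw [← integral_add_right_eq_self (μ := volume) _ v]
  simp [daughter, add_sub_add_right_eq_sub]

lemma waveletTransform_sub {ψ f g : E n → Cl n} (hψ : MemLp ψ 2) (hf : MemLp f 2) (hg : MemLp g 2)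
    {p : (ℝ × SO n) × E n} (hp : 0 < p.1.1) :
    waveletTransform ψ (f - g) p = waveletTransform ψ f p - waveletTransform ψ g p := by
  have hd := memLp_rev (memLp_daughter hψ hp p.1.2 p.2)
  rw [waveletTransform_eq_integral hψ hf hp, waveletTransform_eq_integral hψ hg hp,
    waveletTransform_eq_integral hψ (hf.sub hg) hp,
    ← integral_sub (integrable_mul_of_memLp hf hd) (integrable_mul_of_memLp hg hd)]
  simp [sub_mul]

variable {ν : Measure (SO n)}

/-- Covariance under translations turns the difference into the wavelet transform of a difference of
translates of $f$, to which the isometry applies. The bound replaces an estimate of the derivative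
of $T_\psi f$ in $b$. -/
lemma normSq_waveletTransform_translate_sub_le [SFinite ν] (hn : n % 4 = 2 ∨ n % 4 = 3)
    {ψ : E n → Cl n} {c : ℝ} (hψ : IsAdmissible ν ψ (algebraMap ℝ (Cl n) c)) {f : E n → Cl n}
    (hf : MemLp f 2) (v w : E n) :
    normSq (simMeasure ν) (fun p =>
      waveletTransform ψ f (p.1, p.2 + v) - waveletTransform ψ f (p.1, p.2 + w)) ≤
      ENNReal.ofReal c * (ENNReal.ofReal ((2 * Real.pi) ^ n)⁻¹ *
        ∫⁻ ω, ‖inner ℝ ω (v - w) • cft f ω‖ₑ ^ 2) := by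
  have hv := memLp_translate hf v
  have hw := memLp_translate hf w
  have e : (fun p => waveletTransform ψ f (p.1, p.2 + v) - waveletTransform ψ f (p.1, p.2 + w))
      =ᵐ[simMeasure ν] waveletTransform ψ ((fun x => f (x + v)) - fun x => f (x + w)) := by
    filter_upwards [ae_simMeasure_pos] with p hp
    rw [waveletTransform_sub (memL2_iff.1 hψ.memL2) hv hw hp, waveletTransform_add_right,
      waveletTransform_add_right]
  rw [normSq_congr_ae e, normSq_waveletTransform hn hψ (hv.sub hw)]
  gcongr
  exact normSq_translate_sub_le hn hf v w

end Translation

/-! ### The uncertainty inequality for translations -/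

section Uncertainty

variable {n : ℕ} {X : Type*} [MeasurableSpace X] {m : Measure X}

lemma sq_integral_inner_le {f g : X → Cl n} (hf : MemLp f 2 m) (hg : MemLp g 2 m) :
    (∫ x, inner ℝ (f x) (g x) ∂m) ^ 2 ≤ (∫ x, ‖f x‖ ^ 2 ∂m) * ∫ x, ‖g x‖ ^ 2 ∂m := by
  have h : ∀ s : ℝ, 0 ≤ (∫ x, ‖g x‖ ^ 2 ∂m) * (s * s) +
      2 * (∫ x, inner ℝ (f x) (g x) ∂m) * s + ∫ x, ‖f x‖ ^ 2 ∂m := by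
    intro s
    have h1 := integral_norm_add_sq hf (hg.const_smul s)
    simp only [Pi.smul_apply, norm_smul, inner_smul_right, mul_pow, integral_const_mul,
      Real.norm_eq_abs, sq_abs] at h1
    have h2 : 0 ≤ ∫ x, ‖f x + s • g x‖ ^ 2 ∂m := integral_nonneg fun x => sq_nonneg _
    rw [h1] at h2
    linarith
  have := discrim_le_zero h
  rw [discrim] at this
  linarith

/-- A measure-preserving map that shifts the real function `q` by `t`, applied to `T` with `T` and
`q T` square-integrable: the translation form of the canonical commutation relation. -/
lemma mul_integral_inner_comp {T : X → Cl n} {q : X → ℝ} {t : ℝ} (τ : X ≃ᵐ X)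
    (hτ : MeasurePreserving τ m m) (hq : ∀ x, q (τ x) = q x + t) (hT : MemLp T 2 m)
    (hqT : MemLp (fun x => q x • T x) 2 m) :
    t * ∫ x, inner ℝ (T x) (T (τ x)) ∂m =
      ∫ x, inner ℝ (q x • T x) (T (τ.symm x) - T (τ x)) ∂m := by
  have hU : MemLp (fun x => T (τ x)) 2 m := hT.comp_measurePreserving hτ
  have hU' : MemLp (fun x => T (τ.symm x)) 2 m := hT.comp_measurePreserving hτ.symm
  have i1 := integrable_inner_of_memLp hqT hU
  have i2 := integrable_inner_of_memLp hT hU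
  have h1 : ∫ x, inner ℝ (q x • T x) (T (τ.symm x)) ∂m =
      ∫ x, inner ℝ (q x • T x) (T (τ x)) ∂m + t * ∫ x, inner ℝ (T x) (T (τ x)) ∂m := by
    -- The substitution $x\mapsto\tau x$ turns $q$ into $q+t$ and interchanges the two arguments of
    -- the inner product.
    rw [← hτ.integral_comp', ← integral_const_mul, ← integral_add i1 (i2.const_mul t)]
    refine integral_congr_ae (ae_of_all _ fun x => ?_)
    simp only [MeasurableEquiv.symm_apply_apply, hq, inner_smul_left]
    rw [real_inner_comm]
    simp
    ring
  simp_rw [inner_sub_right]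
  rw [integral_sub (integrable_inner_of_memLp hqT hU') i1, h1]
  ring

/-- Polarization, with $\|T\circ\tau\|=\|T\|$. It quantifies how close the correlation is to
$\|T\|^2$ for a small shift. -/
lemma integral_inner_comp_eq {T : X → Cl n} (τ : X ≃ᵐ X) (hτ : MeasurePreserving τ m m)
    (hT : MemLp T 2 m) :
    ∫ x, inner ℝ (T x) (T (τ x)) ∂m =
      ∫ x, ‖T x‖ ^ 2 ∂m - 2⁻¹ * ∫ x, ‖T (τ x) - T x‖ ^ 2 ∂m := by
  have hU : MemLp (fun x => T (τ x)) 2 m := hT.comp_measurePreserving hτ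
  have h1 := integral_norm_add_sq hU hT.neg
  have h2 : ∫ x, ‖T (τ x)‖ ^ 2 ∂m = ∫ x, ‖T x‖ ^ 2 ∂m := hτ.integral_comp' (fun x => ‖T x‖ ^ 2)
  simp only [Pi.neg_apply, ← sub_eq_add_neg, norm_neg, inner_neg_right, integral_neg, h2] at h1
  have h3 : ∫ x, inner ℝ (T (τ x)) (T x) ∂m = ∫ x, inner ℝ (T x) (T (τ x)) ∂m :=
    integral_congr_ae (ae_of_all _ fun x => real_inner_comm _ _)
  rw [h3] at h1
  rw [h1]
  ring

/-- An uncertainty inequality for a one-parameter family of translations. -/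
lemma sq_integral_norm_sq_le {T : X → Cl n} {q : X → ℝ} (τ : ℝ → X ≃ᵐ X)
    (hτ : ∀ t, MeasurePreserving (τ t) m m) (hq : ∀ t x, q (τ t x) = q x + t)
    (hT : MemLp T 2 m) (hqT : MemLp (fun x => q x • T x) 2 m) {K : ℝ} (hK : 0 ≤ K)
    (h1 : ∀ t, ∫ x, ‖T (τ t x) - T x‖ ^ 2 ∂m ≤ t ^ 2 * K)
    (h2 : ∀ t, ∫ x, ‖T ((τ t).symm x) - T (τ t x)‖ ^ 2 ∂m ≤ (2 * t) ^ 2 * K) :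
    (∫ x, ‖T x‖ ^ 2 ∂m) ^ 2 ≤ 4 * (∫ x, ‖q x • T x‖ ^ 2 ∂m) * K := by
  set N := ∫ x, ‖T x‖ ^ 2 ∂m with hN
  set A := ∫ x, ‖q x • T x‖ ^ 2 ∂m with hA
  have hA0 : 0 ≤ A := integral_nonneg fun x => sq_nonneg _
  have key : ∀ t : ℝ, 0 < t → N - 2⁻¹ * (t ^ 2 * K) ≤ √(4 * A * K) := by
    intro t ht
    have e1 := mul_integral_inner_comp (τ t) (hτ t) (hq t) hT hqT
    have e2 := integral_inner_comp_eq (τ t) (hτ t) hT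
    have hU : MemLp (fun x => T (τ t x)) 2 m := hT.comp_measurePreserving (hτ t)
    have hU' : MemLp (fun x => T ((τ t).symm x)) 2 m := hT.comp_measurePreserving (hτ t).symm
    have e3 := sq_integral_inner_le hqT (hU'.sub hU)
    simp only [Pi.sub_apply] at e3
    rw [← e1] at e3
    have e4 : (t * ∫ x, inner ℝ (T x) (T (τ t x)) ∂m) ^ 2 ≤ t ^ 2 * (4 * A * K) := by
      refine e3.trans ((mul_le_mul_of_nonneg_left (h2 t) hA0).trans_eq ?_)
      ring
    -- Both sides of the Cauchy-Schwarz bound carry $t^2$; after cancellation the right side no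
    -- longer depends on $t$, so $t\to0$ is harmless. The 4 comes from the total displacement $2t$.
    rw [mul_pow, mul_le_mul_iff_right₀ (by positivity)] at e4
    have e5 := Real.le_sqrt_of_sq_le e4
    have := h1 t
    linarith
  have hlim : Tendsto (fun t : ℝ => N - 2⁻¹ * (t ^ 2 * K)) (𝓝[>] 0) (𝓝 N) := by
    have : ContinuousAt (fun t : ℝ => N - 2⁻¹ * (t ^ 2 * K)) 0 := by fun_prop
    simpa using! this.tendsto.mono_left nhdsWithin_le_nhds
  have hfin : N ≤ √(4 * A * K) :=
    le_of_tendsto hlim (eventually_mem_nhdsWithin.mono fun t ht => key t ht)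
  have hN0 : 0 ≤ N := integral_nonneg fun x => sq_nonneg _
  calc N ^ 2 ≤ √(4 * A * K) ^ 2 := by gcongr
    _ = 4 * A * K := Real.sq_sqrt (by positivity)

end Uncertainty

/-! ### The inequality for one coordinate and the summation over coordinates -/

section Main

variable {n : ℕ} {ν : Measure (SO n)}

lemma integral_norm_sq_eq_normSq {α : Type*} [MeasurableSpace α] {μ : Measure α} {f : α → Cl n}
    (hf : MemLp f 2 μ) : ∫ x, ‖f x‖ ^ 2 ∂μ = (normSq μ f).toReal := by
  rw [integral_norm_sq_eq hf, normSq_eq_eLpNorm_sq]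

/-- The translation `(a, θ, b) ↦ (a, θ, b + v)`. -/
def simTranslate (v : E n) : ((ℝ × SO n) × E n) ≃ᵐ ((ℝ × SO n) × E n) :=
  (MeasurableEquiv.refl _).prodCongr (MeasurableEquiv.addRight v)

lemma simTranslate_apply (v : E n) (p : (ℝ × SO n) × E n) : simTranslate v p = (p.1, p.2 + v) := rfl

lemma simTranslate_symm_apply (v : E n) (p : (ℝ × SO n) × E n) :
    (simTranslate v).symm p = (p.1, p.2 + -v) := rfl

lemma measurePreserving_simTranslate [SFinite ν] (v : E n) :
    MeasurePreserving (simTranslate v) (simMeasure ν) (simMeasure ν) :=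
  (MeasurePreserving.id _).prod (measurePreserving_add_right volume v)

/-- The uncertainty inequality for one coordinate. -/
lemma uncertainty_coordinate [SFinite ν] (hn : n % 4 = 2 ∨ n % 4 = 3) {ψ : E n → Cl n} {c : ℝ}
    (hc : 0 < c) (hψ : IsAdmissible ν ψ (algebraMap ℝ (Cl n) c)) {f : E n → Cl n} (hf : MemLp f 2)
    (j : Fin n)
    (hA : normSq (simMeasure ν) (fun p => p.2 j • waveletTransform ψ f p) ≠ ⊤)
    (hB : normSq volume (fun ω => ω j • cft f ω) ≠ ⊤) :
    ENNReal.ofReal (c * ((2 * Real.pi) ^ n / 4)) * normSq volume f ^ 2 ≤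
      normSq (simMeasure ν) (fun p => p.2 j • waveletTransform ψ f p) *
        normSq volume (fun ω => ω j • cft f ω) := by
  have hψ2 : MemLp ψ 2 := memL2_iff.1 hψ.memL2
  set T := waveletTransform ψ f with hTdef
  have hTm : AEStronglyMeasurable T (simMeasure ν) := aestronglyMeasurable_waveletTransform hψ2 hf
  have hTn := normSq_waveletTransform hn hψ hf
  have hNf : normSq volume f ≠ ⊤ := (memL2_iff.2 hf).2.ne
  have hT : MemLp T 2 (simMeasure ν) := by
    rw [← memL2_iff]
    refine ⟨aestronglyMeasurable_iff_coeff.1 hTm, ?_⟩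
    rw [hTn]
    exact ENNReal.mul_lt_top ENNReal.ofReal_lt_top hNf.lt_top
  have hqm : AEStronglyMeasurable (fun p : (ℝ × SO n) × E n => p.2 j) (simMeasure ν) :=
    Measurable.aestronglyMeasurable (by fun_prop)
  have hqT : MemLp (fun p => p.2 j • T p) 2 (simMeasure ν) := by
    rw [← memL2_iff]
    exact ⟨aestronglyMeasurable_iff_coeff.1 (hqm.smul hTm), hA.lt_top⟩
  set B := normSq volume (fun ω => ω j • cft f ω) with hBdef
  -- `K` stands in for the squared norm of $\partial_{b_j}T_\psi f$: the factor `c` comes from the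
  -- isometry, $(2\pi)^{-n}$ from Plancherel.
  set K : ℝ := c * ((2 * Real.pi) ^ n)⁻¹ * B.toReal with hKdef
  have hK : 0 ≤ K := by positivity
  let e : E n := EuclideanSpace.single j 1
  have hB' : ∀ s : ℝ, ∫⁻ ω, ‖inner ℝ ω (s • e) • cft f ω‖ₑ ^ 2 = ENNReal.ofReal (s ^ 2) * B := by
    intro s
    have : ∀ ω : E n, inner ℝ ω (s • e) • cft f ω = s • (ω j • cft f ω) := fun ω => by
      rw [inner_smul_right, EuclideanSpace.inner_single_right, smul_smul]; simp
    simp_rw [this]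
    rw [← normSq_eq_lintegral, normSq_const_smul, ← ofReal_norm, Real.norm_eq_abs,
      ← ENNReal.ofReal_pow (abs_nonneg _), sq_abs]
  have hdiff : ∀ (v w : E n) (s : ℝ), v - w = s • e →
      ∫ p, ‖T (p.1, p.2 + v) - T (p.1, p.2 + w)‖ ^ 2 ∂(simMeasure ν) ≤ s ^ 2 * K := by
    intro v w s hs
    have h := normSq_waveletTransform_translate_sub_le hn hψ hf v w
    rw [hs, hB', ← hTdef] at h
    have hm : ∀ v, MemLp (fun p : (ℝ × SO n) × E n => T (p.1, p.2 + v)) 2 (simMeasure ν) :=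
      fun v => hT.comp_measurePreserving (measurePreserving_simTranslate v)
    refine (integral_norm_sq_eq_normSq ((hm v).sub (hm w))).trans_le ?_
    refine (ENNReal.toReal_mono ?_ h).trans_eq ?_
    · exact ENNReal.mul_ne_top ENNReal.ofReal_ne_top (ENNReal.mul_ne_top ENNReal.ofReal_ne_top
        (ENNReal.mul_ne_top ENNReal.ofReal_ne_top hB))
    · rw [ENNReal.toReal_mul, ENNReal.toReal_mul, ENNReal.toReal_mul,
        ENNReal.toReal_ofReal hc.le, ENNReal.toReal_ofReal (by positivity),
        ENNReal.toReal_ofReal (sq_nonneg s), hKdef]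
      ring
  have hmain := sq_integral_norm_sq_le (T := T) (q := fun p => p.2 j) (m := simMeasure ν) (K := K)
    (fun t => simTranslate (t • e)) (fun t => measurePreserving_simTranslate _)
    (fun t p => by simp [simTranslate_apply, e]) hT hqT hK
    (fun t => by
      have := hdiff (t • e) 0 t (by simp)
      simpa [simTranslate_apply] using this)
    (fun t => by
      have := hdiff (-(t • e)) (t • e) (-(2 * t)) (by module)
      simpa only [simTranslate_apply, simTranslate_symm_apply, neg_sq] using this)
  rw [integral_norm_sq_eq_normSq hT, integral_norm_sq_eq_normSq hqT, hTn, ENNReal.toReal_mul,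
    ENNReal.toReal_ofReal hc.le] at hmain
  set A := normSq (simMeasure ν) (fun p => p.2 j • T p) with hAdef
  rw [← ENNReal.ofReal_toReal hA, ← ENNReal.ofReal_toReal hB, ← ENNReal.ofReal_toReal hNf,
    ← ENNReal.ofReal_pow ENNReal.toReal_nonneg, ← ENNReal.ofReal_mul (by positivity),
    ← ENNReal.ofReal_mul ENNReal.toReal_nonneg]
  refine ENNReal.ofReal_le_ofReal ?_
  have hpi : 0 < (2 * Real.pi) ^ n := by positivity
  -- The left side contains $c^2$ from $\|T\|^4$ and the right side one `c` from `K`; cancelling one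
  -- factor leaves the constant linear in `c`.
  have h4 : c * (c * (normSq volume f).toReal ^ 2) ≤
      c * (4 * A.toReal * B.toReal * ((2 * Real.pi) ^ n)⁻¹) := by
    rw [hKdef] at hmain
    linarith
  have h5 := le_of_mul_le_mul_left h4 hc
  rw [← div_eq_mul_inv, le_div_iff₀ hpi] at h5
  linarith

lemma sum_normSq_coord_smul {α : Type*} [MeasurableSpace α] {μ : Measure α} {g : α → Cl n}
    {v : α → E n} (hv : AEMeasurable v μ) (hg : AEStronglyMeasurable g μ) :
    ∑ j, normSq μ (fun x => v x j • g x) = normSq μ (fun x => vec (v x) * g x) := by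
  simp_rw [normSq_eq_lintegral]
  rw [← lintegral_finsetSum']
  · refine lintegral_congr fun x => ?_
    simp_rw [← ofReal_norm, norm_vec_mul, norm_smul]
    simp_rw [← ENNReal.ofReal_pow (mul_nonneg (norm_nonneg _) (norm_nonneg _)), mul_pow]
    rw [← ENNReal.ofReal_sum_of_nonneg fun _ _ => by positivity, ← Finset.sum_mul,
      EuclideanSpace.norm_sq_eq]
  · intro j _
    have : AEStronglyMeasurable (fun x => v x j) μ :=
      AEMeasurable.aestronglyMeasurable (by fun_prop)
    exact (this.smul hg).enorm.pow_const 2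

/-- Serves the degenerate case $0\cdot\infty=0$ of the main inequality. -/
lemma normSq_eq_zero_of_vec_mul {α : Type*} [MeasurableSpace α] {μ : Measure α} {g : α → Cl n}
    {v : α → E n} (hv : AEMeasurable v μ) (hg : AEStronglyMeasurable g μ)
    (hv0 : ∀ᵐ x ∂μ, v x ≠ 0) (h : normSq μ (fun x => vec (v x) * g x) = 0) : normSq μ g = 0 := by
  rw [normSq_eq_lintegral] at h ⊢
  have e : ∀ x, ‖vec (v x) * g x‖ₑ ^ 2 = (‖v x‖ₑ * ‖g x‖ₑ) ^ 2 := fun x => by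
    rw [← ofReal_norm, norm_vec_mul, ENNReal.ofReal_mul (norm_nonneg _), ofReal_norm, ofReal_norm]
  simp_rw [e] at h
  rw [lintegral_eq_zero_iff' (by exact (hv.enorm.mul hg.enorm).pow_const 2)] at h
  rw [lintegral_eq_zero_iff' (hg.enorm.pow_const 2)]
  filter_upwards [h, hv0] with x hx hx0
  simpa [hx0] using hx

end Main

end CliffordWavelet

end

open CliffordWavelet in
theorem mainTheorem4 (n : ℕ) (hn : n % 4 = 2 ∨ n % 4 = 3)
    (ν : MeasureTheory.Measure (CliffordWavelet.SO n)) [ν.IsHaarMeasure]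
    (ψ : CliffordWavelet.E n → CliffordWavelet.Cl n) (c : ℝ)
    (hψ : CliffordWavelet.IsAdmissible ν ψ (algebraMap ℝ (CliffordWavelet.Cl n) c))
    (f : CliffordWavelet.E n → CliffordWavelet.Cl n)
    (hf : CliffordWavelet.MemL2 MeasureTheory.volume f) :
    ENNReal.ofReal (n * c * ((2 * Real.pi) ^ n / 4)) *
        CliffordWavelet.normSq MeasureTheory.volume f ^ 2 ≤
      CliffordWavelet.normSq (CliffordWavelet.simMeasure ν)
          (fun p => CliffordWavelet.vec p.2 * CliffordWavelet.waveletTransform ψ f p) *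
        CliffordWavelet.normSq MeasureTheory.volume
          (fun ω => CliffordWavelet.vec ω * CliffordWavelet.cft f ω) := by
  rw [memL2_iff] at hf
  have hψ2 : MemLp ψ 2 := memL2_iff.1 hψ.memL2
  -- Positive dimension makes $\{0\}$ a Lebesgue null set, so $b$ and $\omega$ are nonzero almost
  -- everywhere.
  have hn0 : 0 < n := by omega
  have : Nonempty (Fin n) := ⟨⟨0, hn0⟩⟩
  -- For $c\le0$ the left side is zero, because `ENNReal.ofReal` truncates at 0.
  rcases le_or_gt c 0 with hc | hc
  · rw [ENNReal.ofReal_of_nonpos, zero_mul]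
    · exact zero_le
    · have : (n : ℝ) * c ≤ 0 := mul_nonpos_of_nonneg_of_nonpos (by positivity) hc
      exact mul_nonpos_of_nonpos_of_nonneg this (by positivity)
  have hT := aestronglyMeasurable_waveletTransform (ν := ν) hψ2 hf
  have hF := (memLp_cft hn hf).1
  have hzero : normSq volume f = 0 → ENNReal.ofReal (n * c * ((2 * Real.pi) ^ n / 4)) *
      normSq volume f ^ 2 = 0 := fun h => by simp [h]
  have hb : AEMeasurable (fun p : (ℝ × SO n) × E n => p.2) (simMeasure ν) := by fun_prop
  -- An infinite factor settles the claim unless the other factor is zero. A zero factor forces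
  -- $\|f\|=0$, by Plancherel or by the isometry with $c>0$, and then the left side vanishes.
  by_cases hA : normSq (simMeasure ν) (fun p => vec p.2 * waveletTransform ψ f p) = ⊤
  · by_cases hB : normSq volume (fun ω => vec ω * cft f ω) = 0
    · rw [hzero]
      · exact zero_le
      have h := normSq_eq_zero_of_vec_mul (v := fun ω => ω) aemeasurable_id hF
        (by simp [ae_iff]) hB
      rw [normSq_cft hn hf, mul_eq_zero, ENNReal.ofReal_eq_zero] at h
      exact h.resolve_left (not_le.2 (by positivity))
    · rw [hA, ENNReal.top_mul hB]
      exact le_top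
  by_cases hB : normSq volume (fun ω => vec ω * cft f ω) = ⊤
  · by_cases hA0 : normSq (simMeasure ν) (fun p => vec p.2 * waveletTransform ψ f p) = 0
    · rw [hzero]
      · exact zero_le
      have h := normSq_eq_zero_of_vec_mul hb hT
        (Measure.quasiMeasurePreserving_snd.ae (p := fun b : E n => b ≠ 0) (by simp [ae_iff])) hA0
      rw [normSq_waveletTransform hn hψ hf, mul_eq_zero, ENNReal.ofReal_eq_zero] at h
      exact h.resolve_left (not_le.2 hc)
    · rw [hB, ENNReal.mul_top hA0]
      exact le_top
  rw [← sum_normSq_coord_smul hb hT] at hA ⊢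
  rw [← sum_normSq_coord_smul (v := fun ω => ω) aemeasurable_id hF] at hB ⊢
  rw [ENNReal.sum_eq_top] at hA hB
  push Not at hA hB
  calc ENNReal.ofReal (n * c * ((2 * Real.pi) ^ n / 4)) * normSq volume f ^ 2
      = ∑ j : Fin n, ENNReal.ofReal (c * ((2 * Real.pi) ^ n / 4)) * normSq volume f ^ 2 := by
        rw [Finset.sum_const, Finset.card_univ, Fintype.card_fin, nsmul_eq_mul, mul_assoc (n : ℝ),
          ENNReal.ofReal_mul (by positivity), ENNReal.ofReal_natCast, mul_assoc]
    _ ≤ ∑ j : Fin n, normSq (simMeasure ν) (fun p => p.2 j • waveletTransform ψ f p) *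
          normSq volume (fun ω => ω j • cft f ω) :=
        Finset.sum_le_sum fun j hj => uncertainty_coordinate hn hc hψ hf j (hA j hj) (hB j hj)
    -- Only the diagonal terms of the product of the two sums are kept, each `normSq` of
    -- $\omega_j\widehat f$ being at most the full sum; this is where the factor $n$ comes from.
    _ ≤ _ := by
        rw [Finset.sum_mul]
        refine Finset.sum_le_sum fun j hj => ?_
        gcongr
        exact Finset.single_le_sum (f := fun j => normSq volume (fun ω => ω j • cft f ω))
          (fun _ _ => zero_le) hj
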